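/- Let $\Bbbk$ be a field and let $\mathbf a_1,\dots,\mathbf a_r,\mathbf b_1,\dots,\mathbf b_s\in\mathbb Z^d$ be pairwise distinct vectors such that $\sum_i v_i\mathbf a_i+\sum_j u_j\mathbf b_j=0$ with $(\mathbf v,\mathbf u)\in\mathbb N^{r}\times\mathbb N^s$ only if $(\mathbf v,\mathbf u)=0$, and such that every $\mathbf b_j$ lies in the rational cone generated by $E=\{\mathbf a_1,\dots,\mathbf a_r\}$, i.e. $\mathrm{pos}(\mathcal A)=\mathrm{pos}(E)$ for $\mathcal A=\{\mathbf a_1,\dots,\mathbf a_r,\mathbf b_1,\dots,\mathbf b_s\}$. Let $S=\mathbb N\mathbf a_1+\dots+\mathbb N\mathbf a_r+\mathbb N\mathbf b_1+\dots+\mathbb N\mathbf b_s$, let $\deg_{\mathcal A}(\mathbf v,\mathbf u)=\sum_i v_i\mathbf a_i+\sum_j u_j\mathbf b_j$, and let $I_{\mathcal A}$ be the kernel of $$\Bbbk[\mathbf Y,\mathbf Z]=\Bbbk[Y_1,\dots,Y_r,Z_1,\dots,Z_s]\to\Bbbk[S]=\bigoplus_{\mathbf a\in S}\Bbbk\,\chi^{\mathbf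 a},\qquad \mathbf Y^{\mathbf v}\mathbf Z^{\mathbf u}\mapsto\chi^{\deg_{\mathcal A}(\mathbf v,\mathbf u)} .$$ Let $\prec$ be an $\mathcal A$-graded reverse lexicographic order on $\Bbbk[\mathbf Y,\mathbf Z]$ with $Y_i\prec Z_j$ for all $i,j$: $m'\prec m$ if and only if the leftmost nonzero entry of $\deg_{\mathcal A}(m)-\deg_{\mathcal A}(m')$ is positive, or the degrees agree and, at the smallest variable in which the exponents of $m$ and $m'$ differ, $m'$ has the larger exponent. Let $\mathcal Q=\{\mathbf u\in\mathbb N^s\mid \mathbf Z^{\mathbf u}\notin\mathrm{in}_\prec(I_{\mathcal A})\}$. For $\mathbf a\in S$ put $$T_{\mathbf a}=\Big\{F\subseteq E\ \Big|\ \mathbf a-\sum_{\mathbf e\in F}\mathbf e\in S\Big\},$$ $$C_{\mathbf a}=\{\mathbf Y^{\mathbf v}\mid \deg_{\mathcal A}(\mathbf v,\mathbf u)=\mathbf a\text{ for some }\mathbf u\in\mathcal Q\},\qquad \Gamma_{\mathbf a}=\{F\subseteq C_{\mathbf a}\mid \gcd(F)\neq1\},$$ where the empty set is a face of $\Gamma_{\mathbf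 a}$. Let $\widetilde H_i(-)$ denote the $i$-th reduced simplicial homology $\Bbbk$-vector space. (1) For every $\mathbf a\in S$ and every integer $i$, $$\widetilde H_i(\Gamma_{\mathbf a})\cong\widetilde H_i(T_{\mathbf a}).$$ (2) Consequently $\Gamma_{\mathbf a}$ computes the Betti numbers of Pisón's resolution. Regard $\Bbbk[S]$ as a module over $\Bbbk[\mathbf Y]$ through $Y_i\mapsto\chi^{\mathbf a_i}$, and let $$\cdots\to\Bbbk[\mathbf Y]^{\beta_2}\xrightarrow{\psi_2}\Bbbk[\mathbf Y]^{\beta_1}\xrightarrow{\psi_1}\Bbbk[\mathbf Y]^{\beta_0}\xrightarrow{\psi_0}\Bbbk[S]\to0$$ be any minimal $\mathcal A$-graded free resolution of $\Bbbk[S]$ as a $\Bbbk[\mathbf Y]$-module. Write $M_i=\ker\psi_i$, $\mathfrak m_E=\langle Y_1,\dots,Y_r\rangle$ and $W_i(\mathbf a)=(M_i/\mathfrak m_EM_i)_{\mathbf a}$. Then for every $\mathbf a\in S$, $$\widetilde H_i(\Gamma_{\mathbf a})\cong W_i(\mathbf a)\quad\text{for every } i\ge0,$$ and, for every $p\ge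 0$, the number of basis elements of degree $\mathbf a$ in $\Bbbk[\mathbf Y]^{\beta_p}$ equals $\dim_\Bbbk\widetilde H_{p-1}(\Gamma_{\mathbf a})$. -/

import Mathlib

namespace ShortResolution

/-! Throughout, `A (Sum.inl i)` are the vectors `aᵢ ∈ E` (variables `Yᵢ`) and `A (Sum.inr j)` are
the vectors `bⱼ ∈ B` (variables `Zⱼ`). A monomial is represented by its exponent vector. -/

/-! ### The affine semigroup, its factorizations and its semigroup algebra -/

/-- The subsemigroup `S` of `ℤ^d` generated by the family `A`. -/
def semigroup {d r s : ℕ} (A : Fin r ⊕ Fin s → Fin d → ℤ) : AddSubmonoid (Fin d → ℤ) :=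
  AddSubmonoid.closure (Set.range A)

/-- The generators, as elements of `S`. -/
def gen {d r s : ℕ} (A : Fin r ⊕ Fin s → Fin d → ℤ) (x : Fin r ⊕ Fin s) : semigroup A :=
  ⟨A x, AddSubmonoid.subset_closure (Set.mem_range_self x)⟩

/-- The factorization map `deg_A : ℕⁿ → S`. -/
def degA {d r s : ℕ} (A : Fin r ⊕ Fin s → Fin d → ℤ) (m : Fin r ⊕ Fin s →₀ ℕ) : semigroup A :=
  ∑ x, m x • gen A x

/-- The `A`-degree of a monomial `Y^v`. -/
def degE {d r s : ℕ} (A : Fin r ⊕ Fin s → Fin d → ℤ) (v : Fin r →₀ ℕ) : semigroup A :=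
  ∑ i, v i • gen A (Sum.inl i)

/-- `∑ uᵢ aᵢ = 0` with `u ∈ ℕⁿ` only for `u = 0` (the condition `S ∩ (-S) = 0`, with no generator
equal to zero). -/
def FiniteFactorizations {d r s : ℕ} (A : Fin r ⊕ Fin s → Fin d → ℤ) : Prop :=
  ∀ m : Fin r ⊕ Fin s → ℕ, ∑ x, m x • A x = 0 → m = 0

/-- The rational polyhedral cone spanned by a finite family of integer vectors. -/
def pos {d : ℕ} {ι : Type} [Fintype ι] (v : ι → Fin d → ℤ) : Set (Fin d → ℚ) :=
  {x | ∃ c : ι → ℚ, (∀ i, 0 ≤ c i) ∧ x = ∑ i, c i • fun l => (v i l : ℚ)}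

/-- The partition `A = E ∪ B` is a convex partition: `pos(A) = pos(E)`. -/
def IsConvexPartition {d r s : ℕ} (A : Fin r ⊕ Fin s → Fin d → ℤ) : Prop :=
  pos A = pos fun i => A (Sum.inl i)

/-- The `k`-algebra map `φ_A : k[Y, Z] → k[S]`, sending a monomial `m` to `χ^{deg_A m}`. -/
noncomputable def phiA {d r s : ℕ} (A : Fin r ⊕ Fin s → Fin d → ℤ) (k : Type*) [Field k] :
    MvPolynomial (Fin r ⊕ Fin s) k →ₐ[k] AddMonoidAlgebra k (semigroup A) :=
  MvPolynomial.aeval fun x => AddMonoidAlgebra.single (gen A x) 1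

/-- The toric ideal `I_A = ker φ_A`. -/
noncomputable def toricIdeal {d r s : ℕ} (A : Fin r ⊕ Fin s → Fin d → ℤ) (k : Type*) [Field k] :
    Ideal (MvPolynomial (Fin r ⊕ Fin s) k) :=
  RingHom.ker (phiA A k)

/-- The composition `k[Y] → k[S_E] ↪ k[S]`, which gives `k[S]` its `k[Y]`-module structure. -/
noncomputable def phiE {d r s : ℕ} (A : Fin r ⊕ Fin s → Fin d → ℤ) (k : Type*) [Field k] :
    MvPolynomial (Fin r) k →ₐ[k] AddMonoidAlgebra k (semigroup A) :=
  MvPolynomial.aeval fun i => AddMonoidAlgebra.single (gen A (Sum.inl i)) 1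

/-! ### The monomial order and the exponents of the standard monomials in `Z` -/

/-- The ranking `ρ` of the variables (smaller rank = smaller variable) is strict and puts every
`Yᵢ` before every `Zⱼ`. -/
def IsVariableOrder {r s : ℕ} (ρ : Fin r ⊕ Fin s → ℕ) : Prop :=
  Function.Injective ρ ∧ ∀ i j, ρ (Sum.inl i) < ρ (Sum.inr j)

/-- Reverse lexicographic order: `m' ≺ m` iff at the smallest variable where the two differ,
`m'` has the larger exponent. -/
def Revlex {r s : ℕ} (ρ : Fin r ⊕ Fin s → ℕ) (m' m : Fin r ⊕ Fin s →₀ ℕ) : Prop :=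
  ∃ x, m x < m' x ∧ ∀ y, ρ y < ρ x → m' y = m y

/-- The `A`-graded reverse lexicographic order `m' ≺ m`: the leftmost nonzero entry of
`deg_A m - deg_A m'` is positive, or the degrees agree and `m'` is revlex smaller than `m`. -/
def Prec {d r s : ℕ} (A : Fin r ⊕ Fin s → Fin d → ℤ) (ρ : Fin r ⊕ Fin s → ℕ)
    (m' m : Fin r ⊕ Fin s →₀ ℕ) : Prop :=
  (∃ l : Fin d, (degA A m' : Fin d → ℤ) l < (degA A m : Fin d → ℤ) l ∧
      ∀ l' < l, (degA A m' : Fin d → ℤ) l' = (degA A m : Fin d → ℤ) l') ∨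
    (degA A m' = degA A m ∧ Revlex ρ m' m)

/-- The initial ideal `in_≺(I_A)`, generated by the leading monomials of the elements of `I_A`. -/
noncomputable def initialIdeal {d r s : ℕ} (A : Fin r ⊕ Fin s → Fin d → ℤ)
    (ρ : Fin r ⊕ Fin s → ℕ) (k : Type*) [Field k] : Ideal (MvPolynomial (Fin r ⊕ Fin s) k) :=
  Ideal.span {g | ∃ f ∈ toricIdeal A k, ∃ m ∈ f.support,
    (∀ m' ∈ f.support, m' ≠ m → Prec A ρ m' m) ∧ g = MvPolynomial.monomial m 1}

/-- `Q = {u ∈ ℕ^s | Z^u ∉ in_≺(I_A)}`. -/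
noncomputable def Q {d r s : ℕ} (A : Fin r ⊕ Fin s → Fin d → ℤ)
    (ρ : Fin r ⊕ Fin s → ℕ) (k : Type*) [Field k] : Set (Fin s →₀ ℕ) :=
  {u | MvPolynomial.monomial (Finsupp.sumElim 0 u) (1 : k) ∉ initialIdeal A ρ k}

/-! ### Subquotients -/

/-- The subquotient `N / (B ∩ N)` of a `k`-vector space; it is `N / B` when `B ⊆ N`. -/
def Subquotient {k M : Type*} [Field k] [AddCommGroup M] [Module k M] (N B : Submodule k M) :
    Type _ :=
  N ⧸ B.submoduleOf N

instance {k M : Type*} [Field k] [AddCommGroup M] [Module k M] (N B : Submodule k M) :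
    AddCommGroup (Subquotient N B) :=
  inferInstanceAs (AddCommGroup (N ⧸ B.submoduleOf N))

instance {k M : Type*} [Field k] [AddCommGroup M] [Module k M] (N B : Submodule k M) :
    Module k (Subquotient N B) :=
  inferInstanceAs (Module k (N ⧸ B.submoduleOf N))

/-! ### Reduced simplicial homology

An abstract simplicial complex with vertices in `V` is a family of finite subsets of `V` closed
under taking subsets, i.e. a `LowerSet (Finset V)`; the empty set is a face of dimension `-1`. -/

/-- The (augmented) simplicial boundary `∂σ = ∑_{x ∈ σ} (-1)^{#{y ∈ σ | y < x}} (σ \ {x})`. -/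
noncomputable def boundary (k : Type*) [Field k] (V : Type*) [LinearOrder V] :
    (Finset V →₀ k) →ₗ[k] (Finset V →₀ k) :=
  Finsupp.linearCombination k fun σ : Finset V =>
    ∑ x ∈ σ, Finsupp.single (σ.erase x) ((-1 : k) ^ (σ.filter (· < x)).card)

/-- The `i`-chains: combinations of the faces with `i + 1` vertices. -/
noncomputable def chains (k : Type*) [Field k] {V : Type*} (Δ : LowerSet (Finset V)) (i : ℤ) :
    Submodule k (Finset V →₀ k) :=
  Finsupp.supported k k {σ | σ ∈ Δ ∧ (σ.card : ℤ) = i + 1}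

/-- The reduced `i`-cycles. -/
noncomputable def cycles (k : Type*) [Field k] {V : Type*} [LinearOrder V]
    (Δ : LowerSet (Finset V)) (i : ℤ) : Submodule k (Finset V →₀ k) :=
  chains k Δ i ⊓ LinearMap.ker (boundary k V)

/-- The `i`-boundaries. -/
noncomputable def boundaries (k : Type*) [Field k] {V : Type*} [LinearOrder V]
    (Δ : LowerSet (Finset V)) (i : ℤ) : Submodule k (Finset V →₀ k) :=
  (chains k Δ (i + 1)).map (boundary k V)

/-- The `i`-th reduced homology `k`-vector space of `Δ`. -/
abbrev ReducedHomology (k : Type*) [Field k] {V : Type*} [LinearOrder V]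
    (Δ : LowerSet (Finset V)) (i : ℤ) : Type _ :=
  Subquotient (cycles k Δ i) (boundaries k Δ i)

/-! ### The two simplicial complexes -/

/-- `T_a = {F ⊆ E | a - ∑_{e ∈ F} e ∈ S}`. -/
def T {d r s : ℕ} (A : Fin r ⊕ Fin s → Fin d → ℤ) (a : semigroup A) :
    LowerSet (Finset (Fin r)) where
  carrier := {F | (a : Fin d → ℤ) - ∑ i ∈ F, A (Sum.inl i) ∈ semigroup A}
  lower' := by
    intro F G hGF hF
    have h : (a : Fin d → ℤ) - ∑ i ∈ G, A (Sum.inl i) =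
        ((a : Fin d → ℤ) - ∑ i ∈ F, A (Sum.inl i)) + ∑ i ∈ F \ G, A (Sum.inl i) := by
      rw [← Finset.sum_sdiff hGF]; abel
    change (a : Fin d → ℤ) - ∑ i ∈ G, A (Sum.inl i) ∈ semigroup A
    rw [h]
    exact add_mem hF (sum_mem fun i _ => (gen A (Sum.inl i)).2)

/-- `C_a`: the monomials `Y^v` with `deg_A (v, u) = a` for some `u ∈ Q`. (`Lex` only serves to
order the vertices, as needed for the signs of the boundary map.) -/
def C {d r s : ℕ} (A : Fin r ⊕ Fin s → Fin d → ℤ) (ρ : Fin r ⊕ Fin s → ℕ)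
    (k : Type*) [Field k] (a : semigroup A) : Set (Lex (Fin r →₀ ℕ)) :=
  {v | ∃ u ∈ Q A ρ k, degA A (Finsupp.sumElim (ofLex v) u) = a}

/-- `Γ_a = {F ⊆ C_a | gcd(F) ≠ 1}`. The exponent of the gcd of a nonempty set of monomials is the
componentwise minimum of the exponents; the empty set (whose gcd is `0`) is a face. -/
def Γ {d r s : ℕ} (A : Fin r ⊕ Fin s → Fin d → ℤ) (ρ : Fin r ⊕ Fin s → ℕ)
    (k : Type*) [Field k] (a : semigroup A) : LowerSet (Finset (Lex (Fin r →₀ ℕ))) where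
  carrier := {F | (F : Set (Lex (Fin r →₀ ℕ))) ⊆ C A ρ k a ∧
    ∀ h : F.Nonempty, F.inf' h (fun v => (ofLex v : Fin r →₀ ℕ)) ≠ 0}
  lower' := by
    intro F G hGF hF
    refine ⟨fun v hv => hF.1 (hGF hv), fun h h0 => hF.2 (h.mono hGF) ?_⟩
    exact le_antisymm (h0 ▸ Finset.inf'_mono _ hGF h) (bot_le)

/-! ### Graded free resolutions over `k[Y]` and Betti numbers -/

/-- An `A`-graded free resolution `⋯ → k[Y]^{β₁} → k[Y]^{β₀} → k[S]` of `k[S]` as a `k[Y]`-module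
by finitely generated free modules. The basis vector `ε_j` of `k[Y]^{β_p}` has degree `deg p j`.
The map `aug` is `ψ₀` and `map p` is `ψ_{p+1}`; `ψ₀` is `k[Y]`-linear for the module structure
of `k[S]` given by `phiE`. -/
structure GradedFreeResolution {d r s : ℕ} (A : Fin r ⊕ Fin s → Fin d → ℤ)
    (k : Type*) [Field k] where
  β : ℕ → ℕ
  deg : ∀ p, Fin (β p) → semigroup A
  aug : (Fin (β 0) → MvPolynomial (Fin r) k)
    →ₛₗ[(phiE A k : MvPolynomial (Fin r) k →+* AddMonoidAlgebra k (semigroup A))]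
      AddMonoidAlgebra k (semigroup A)
  map : ∀ p, (Fin (β (p + 1)) → MvPolynomial (Fin r) k) →ₗ[MvPolynomial (Fin r) k]
    (Fin (β p) → MvPolynomial (Fin r) k)
  aug_homogeneous : ∀ j, ∃ c : k, aug (Pi.single j 1) = AddMonoidAlgebra.single (deg 0 j) c
  map_homogeneous : ∀ p j l, ∀ v ∈ (map p (Pi.single j 1) l).support,
    degE A v + deg p l = deg (p + 1) j
  aug_surjective : Function.Surjective aug
  exact_zero : LinearMap.range (map 0) = LinearMap.ker aug
  exact_succ : ∀ p, LinearMap.range (map (p + 1)) = LinearMap.ker (map p)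

namespace GradedFreeResolution

/-- The resolution is minimal: the differentials vanish modulo the irrelevant ideal. -/
def IsMinimal {d r s : ℕ} {A : Fin r ⊕ Fin s → Fin d → ℤ} {k : Type*} [Field k]
    (P : GradedFreeResolution A k) : Prop :=
  ∀ p j l, MvPolynomial.constantCoeff (P.map p (Pi.single j 1) l) = 0

/-- `M_p = ker ψ_p`. -/
noncomputable def M {d r s : ℕ} {A : Fin r ⊕ Fin s → Fin d → ℤ} {k : Type*} [Field k]
    (P : GradedFreeResolution A k) :
    ∀ p, Submodule (MvPolynomial (Fin r) k) (Fin (P.β p) → MvPolynomial (Fin r) k)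
  | 0 => LinearMap.ker P.aug
  | p + 1 => LinearMap.ker (P.map p)

/-- The elements of `k[Y]^{β_p}` that are homogeneous of `A`-degree `a`. -/
def component {d r s : ℕ} {A : Fin r ⊕ Fin s → Fin d → ℤ} {k : Type*} [Field k]
    (P : GradedFreeResolution A k) (p : ℕ) (a : semigroup A) :
    Submodule k (Fin (P.β p) → MvPolynomial (Fin r) k) where
  carrier := {f | ∀ j, ∀ v ∈ (f j).support, degE A v + P.deg p j = a}
  zero_mem' := by simp
  add_mem' := by
    intro f g hf hg j v hv
    rcases Finset.mem_union.1 (MvPolynomial.support_add hv) with h | h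
    · exact hf j v h
    · exact hg j v h
  smul_mem' := by
    intro c f hf j v hv
    exact hf j v (MvPolynomial.support_smul hv)

/-- The component `(M_p)_a` of `M_p` in degree `a`. -/
noncomputable def MComponent {d r s : ℕ} {A : Fin r ⊕ Fin s → Fin d → ℤ} {k : Type*} [Field k]
    (P : GradedFreeResolution A k) (p : ℕ) (a : semigroup A) :
    Submodule k (Fin (P.β p) → MvPolynomial (Fin r) k) :=
  P.component p a ⊓ (P.M p).restrictScalars k

/-- `W_p(a) = (M_p / 𝔪_E M_p)_a`, where `𝔪_E = ⟨Y₁, …, Y_r⟩`; that is, `(M_p)_a` modulo its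
intersection with `𝔪_E M_p`. -/
abbrev W {d r s : ℕ} {A : Fin r ⊕ Fin s → Fin d → ℤ} {k : Type*} [Field k]
    (P : GradedFreeResolution A k) (p : ℕ) (a : semigroup A) : Type _ :=
  Subquotient (P.MComponent p a)
    ((Ideal.span (Set.range (MvPolynomial.X : Fin r → MvPolynomial (Fin r) k)) •
      P.M p).restrictScalars k)

/-- The `p`-th Betti number in degree `a`: the number of basis elements of degree `a` of the
`p`-th free module of the resolution. -/
noncomputable def betti {d r s : ℕ} {A : Fin r ⊕ Fin s → Fin d → ℤ} {k : Type*} [Field k]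
    (P : GradedFreeResolution A k) (p : ℕ) (a : semigroup A) : ℕ :=
  Nat.card {j : Fin (P.β p) // P.deg p j = a}

end GradedFreeResolution

end ShortResolution

open ShortResolution

/-! The comparison of `Γ` and `T` is Dowker duality for the relation "`Y_i` divides the monomial
`Y^v` of `C_a`". A nonempty set of monomials is a face of `Γ_a` exactly when one variable divides
all of them (`mem_Γ`). A nonempty set of variables is a face of `T_a` exactly when all of them
divide one monomial of `C_a`. The second equivalence rests on `exists_le_standard`: among the
finitely many factorizations of `a` whose `Y`-part is at least a given one, a revlex minimal one has
a standard `Z`-part. Otherwise its `Z`-part is divisible by a leading monomial of some `f ∈ I_A`;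
`f` has a second monomial of the same degree, necessarily revlex smaller, and exchanging the two
gives a smaller factorization without lowering the `Y`-part.

Duality itself (`dowker`) is proved on the disjoint union of the two vertex sets, with `H` a face
when its two parts are faces and all cross pairs are related. The faces with a fixed nonempty part
`F` on one side form a cone with apex any vertex related to all of `F`, so they can be discarded
without changing homology. Discarding on either side leaves one of the two complexes.

For the resolution, the degree `a` strand of the Koszul complex of `k[S]`, that is `Tor(k[S], k)_a`,
is computed twice. Its summand at `F` is the component of `k[S]` of degree `a - ∑_{e ∈ F} e`, a line
if `F ∈ T_a` and zero otherwise, so the strand is the augmented chain complex of `T_a` with indices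
shifted by one. On the other hand, the Koszul complex of a free module has only its constants as
homology (`exists_koszul_mulX_eq`), so along a minimal resolution `H_{n+1}(k[S]) ≅ H_0(M_n)`. This
last space is `W_n(a)`, and its dimension counts the degree `a` basis elements of the free module
covering `M_n`.

All complexes are families of subspaces of one vector space with one endomorphism, which keeps
homology a plain subquotient. -/

namespace ShortResolution

/-! ### Homology of a family of subspaces under an endomorphism -/

section Homology

variable {k V W P : Type*} [Field k] [AddCommGroup V] [Module k V] [AddCommGroup W] [Module k W]
  [AddCommGroup P] [Module k P]

/-- Two subquotients are isomorphic if they are images of the same space with the same kernel. -/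
theorem subquotient_equiv {N B : Submodule k V} {N' B' : Submodule k W}
    (f : P →ₗ[k] V) (g : P →ₗ[k] W) (hf : ∀ p, f p ∈ N) (hg : ∀ p, g p ∈ N')
    (hfs : ∀ n ∈ N, ∃ p, n - f p ∈ B) (hgs : ∀ n ∈ N', ∃ p, n - g p ∈ B')
    (h : ∀ p, f p ∈ B ↔ g p ∈ B') :
    Nonempty (Subquotient N B ≃ₗ[k] Subquotient N' B') := by
  let F : P →ₗ[k] (N ⧸ B.submoduleOf N) := (B.submoduleOf N).mkQ ∘ₗ f.codRestrict N hf
  let G : P →ₗ[k] (N' ⧸ B'.submoduleOf N') := (B'.submoduleOf N').mkQ ∘ₗ g.codRestrict N' hg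
  have hF : Function.Surjective F := by
    intro x
    obtain ⟨⟨n, hn⟩, rfl⟩ := Submodule.mkQ_surjective _ x
    obtain ⟨p, hp⟩ := hfs n hn
    exact ⟨p, ((Submodule.Quotient.eq (B.submoduleOf N) (x := ⟨n, hn⟩) (y := ⟨f p, hf p⟩)).2 hp).symm⟩
  have hG : Function.Surjective G := by
    intro x
    obtain ⟨⟨n, hn⟩, rfl⟩ := Submodule.mkQ_surjective _ x
    obtain ⟨p, hp⟩ := hgs n hn
    exact ⟨p, ((Submodule.Quotient.eq (B'.submoduleOf N') (x := ⟨n, hn⟩) (y := ⟨g p, hg p⟩)).2 hp).symm⟩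
  have hk : LinearMap.ker F = LinearMap.ker G := by
    ext p
    rw [LinearMap.mem_ker, LinearMap.mem_ker]
    exact ((Submodule.Quotient.mk_eq_zero (B.submoduleOf N) (x := ⟨f p, hf p⟩)).trans (h p)).trans
      (Submodule.Quotient.mk_eq_zero (B'.submoduleOf N') (x := ⟨g p, hg p⟩)).symm
  exact ⟨(F.quotKerEquivOfSurjective hF).symm.trans
    ((Submodule.quotEquivOfEq _ _ hk).trans (G.quotKerEquivOfSurjective hG))⟩

/-- The homology in degree `i` of the graded family of subspaces `A` under the differential `D`. -/
abbrev Homology (D : V →ₗ[k] V) (A : ℤ → Submodule k V) (i : ℤ) : Type _ :=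
  Subquotient (A i ⊓ LinearMap.ker D) ((A (i + 1)).map D)

/-- A subcomplex with acyclic quotient has the same homology. -/
theorem homology_equiv_of_acyclic_quotient {D : V →ₗ[k] V} (hD : D ∘ₗ D = 0)
    {A X : ℤ → Submodule k V} (hAX : ∀ i, A i ≤ X i)
    (h : ∀ i, ∀ z ∈ X (i + 1), D z ∈ A i → ∃ w ∈ X (i + 1 + 1), z - D w ∈ A (i + 1)) (i : ℤ) :
    Nonempty (Homology D A i ≃ₗ[k] Homology D X i) := by
  have hDD : ∀ z, D (D z) = 0 := fun z => LinearMap.congr_fun hD z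
  -- Acyclicity of the quotient is needed in two consecutive degrees: here for surjectivity, and
  -- unshifted for injectivity.
  have h' : ∀ z ∈ X i, D z ∈ A (i - 1) → ∃ w ∈ X (i + 1), z - D w ∈ A i := by
    have := h (i - 1)
    rwa [sub_add_cancel] at this
  refine subquotient_equiv (P := (A i ⊓ LinearMap.ker D : Submodule k V)) (Submodule.subtype _)
    (Submodule.subtype _) (fun p => p.2) (fun p => ⟨hAX i p.2.1, p.2.2⟩)
    (fun n hn => ⟨⟨n, hn⟩, by simp⟩) ?_ ?_
  · rintro n ⟨hn, hn'⟩
    replace hn' : D n = 0 := hn'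
    obtain ⟨w, hw, hnw⟩ := h' n hn (hn' ▸ zero_mem _)
    exact ⟨⟨n - D w, hnw, by simp [hn', hDD]⟩, w, hw, by simp⟩
  · rintro ⟨z, hz, hz'⟩
    constructor
    · rintro ⟨w, hw, hwz⟩
      exact ⟨w, hAX _ hw, hwz⟩
    · rintro ⟨w, hw, hwz⟩
      obtain ⟨u, hu, hwu⟩ := h i w hw (hwz ▸ hz)
      exact ⟨w - D u, hwu, by simpa [hDD] using hwz⟩

/-- Homology is transported along a chain map that is bijective on the graded pieces. -/
theorem homology_equiv_of_bijective {D : V →ₗ[k] V} {D' : W →ₗ[k] W} (f : V →ₗ[k] W)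
    (hf : f ∘ₗ D = D' ∘ₗ f) {A : ℤ → Submodule k V} {A' : ℤ → Submodule k W} {i j : ℤ}
    (hD : ∀ z ∈ A (i + 1), D z ∈ A i)
    (hi : (A i).map f = A' j) (hi' : (A (i + 1)).map f = A' (j + 1))
    (hinj : ∀ z ∈ A i, f z = 0 → z = 0) (hinj' : ∀ z ∈ A (i - 1), f z = 0 → z = 0)
    (hD' : ∀ z ∈ A i, D z ∈ A (i - 1)) :
    Nonempty (Homology D A i ≃ₗ[k] Homology D' A' j) := by
  have hfD : ∀ z, f (D z) = D' (f z) := fun z => LinearMap.congr_fun hf z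
  refine subquotient_equiv (P := (A i ⊓ LinearMap.ker D : Submodule k V)) (Submodule.subtype _)
    (f ∘ₗ Submodule.subtype _) (fun p => p.2) ?_ (fun n hn => ⟨⟨n, hn⟩, by simp⟩) ?_ ?_
  · rintro ⟨z, hz, hz'⟩
    replace hz' : D z = 0 := hz'
    refine ⟨hi ▸ ⟨z, hz, rfl⟩, ?_⟩
    simp [← hfD, hz']
  · rintro n ⟨hn, hn'⟩
    rw [← hi] at hn
    obtain ⟨z, hz, rfl⟩ := hn
    refine ⟨⟨z, hz, hinj' _ (hD' z hz) ?_⟩, by simp⟩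
    rw [hfD]; exact hn'
  · rintro ⟨z, hz, hz'⟩
    constructor
    · rintro ⟨w, hw, hwz⟩
      refine ⟨f w, hi' ▸ ⟨w, hw, rfl⟩, ?_⟩
      rw [← hfD, hwz]; rfl
    · rintro ⟨u, hu, hu'⟩
      rw [← hi'] at hu
      obtain ⟨w, hw, rfl⟩ := hu
      refine ⟨w, hw, ?_⟩
      rw [← hfD] at hu'
      have : f (D w - z) = 0 := by
        rw [map_sub, hu']; simp
      exact sub_eq_zero.1 (hinj _ (sub_mem (hD w hw) hz) this)

/-- Dimension shifting: the connecting isomorphism of a short exact sequence of complexes whose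
middle term is acyclic in the relevant degrees. -/
theorem homology_connecting_equiv {D : V →ₗ[k] V} {D' : W →ₗ[k] W} (hDD' : D' ∘ₗ D' = 0)
    (f : W →ₗ[k] V) (hf : f ∘ₗ D' = D ∘ₗ f) {A : ℤ → Submodule k V} {A' : ℤ → Submodule k W}
    {i : ℤ} (hD' : ∀ i, ∀ z ∈ A' (i + 1), D' z ∈ A' i) (hfA : ∀ i, (A' i).map f = A i)
    (hex : ∀ z ∈ A' (i + 1), D' z = 0 → ∃ w ∈ A' (i + 1 + 1), D' w = z)
    (hex' : ∀ z ∈ A' i, D' z = 0 → f z = 0 → ∃ w ∈ A' (i + 1), D' w = z) :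
    Nonempty (Homology D A (i + 1) ≃ₗ[k]
      Homology D' (fun i => A' i ⊓ LinearMap.ker f) i) := by
  have hfD : ∀ z, f (D' z) = D (f z) := fun z => LinearMap.congr_fun hf z
  have hDD : ∀ z, D' (D' z) = 0 := fun z => LinearMap.congr_fun hDD' z
  -- The snake: a chain `z` of the middle complex with `f (D' z) = 0` represents the class of `f z`
  -- on one side and its connecting image `D' z` on the other.
  refine subquotient_equiv (P := (A' (i + 1) ⊓ LinearMap.ker (f ∘ₗ D') : Submodule k W))
    (f ∘ₗ Submodule.subtype _) (D' ∘ₗ Submodule.subtype _) ?_ ?_ ?_ ?_ ?_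
  · rintro ⟨z, hz, hz'⟩
    refine ⟨hfA _ ▸ ⟨z, hz, rfl⟩, ?_⟩
    replace hz' : f (D' z) = 0 := hz'
    change D (f z) = 0
    rw [← hfD, hz']
  · rintro ⟨z, hz, hz'⟩
    exact ⟨⟨hD' _ _ hz, hz'⟩, hDD z⟩
  · rintro n ⟨hn, hn'⟩
    rw [← hfA] at hn
    obtain ⟨z, hz, rfl⟩ := hn
    exact ⟨⟨z, hz, (hfD z).trans hn'⟩, by simp⟩
  · rintro n ⟨⟨hn, hn'⟩, hn''⟩
    obtain ⟨w, hw, rfl⟩ := hex' n hn hn'' hn'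
    exact ⟨⟨w, hw, hn'⟩, by simp⟩
  · rintro ⟨z, hz, hz'⟩
    constructor
    · rintro ⟨y, hy, hyz⟩
      rw [← hfA] at hy
      obtain ⟨y, hy, rfl⟩ := hy
      refine ⟨z - D' y, ⟨sub_mem hz (hD' _ _ hy), ?_⟩, by simp [hDD]⟩
      change f (z - D' y) = 0
      rw [map_sub, hfD, hyz]
      simp
    · rintro ⟨u, ⟨hu, hu'⟩, huz⟩
      replace hu' : f u = 0 := hu'
      obtain ⟨y, hy, hyz⟩ := hex (z - u) (sub_mem hz hu) (by simp [huz])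
      refine ⟨f y, hfA _ ▸ ⟨y, hy, rfl⟩, ?_⟩
      simp [← hfD, hyz, hu']

end Homology

/-! ### Koszul complexes -/

section Koszul

variable (k : Type*) {X N N' : Type*} [Field k] [LinearOrder X] [AddCommGroup N] [Module k N]
  [AddCommGroup N'] [Module k N']

/-- The sign of `x` in the boundary of the simplex `F`. -/
def sgn (x : X) (F : Finset X) : k := (-1) ^ (F.filter (· < x)).card

variable {k}

theorem sgn_mul_self (x : X) (F : Finset X) : sgn k x F * sgn k x F = 1 := by
  rw [sgn, ← pow_add, ← two_mul, pow_mul]; simp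

theorem sgn_insert_self (x : X) (F : Finset X) : sgn k x (insert x F) = sgn k x F := by
  simp [sgn, Finset.filter_insert]

theorem sgn_erase_self (x : X) (F : Finset X) : sgn k x (F.erase x) = sgn k x F := by
  rw [sgn, sgn, Finset.filter_erase, Finset.erase_eq_of_notMem (by simp)]

theorem sgn_insert {x y : X} {F : Finset X} (hy : y ∉ F) :
    sgn k x (insert y F) = if y < x then -sgn k x F else sgn k x F := by
  unfold sgn
  rw [Finset.filter_insert]
  split_ifs with h
  · rw [Finset.card_insert_of_notMem (by simp [hy]), pow_succ]; ring
  · rfl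

theorem sgn_erase {x y : X} {F : Finset X} (hy : y ∈ F) :
    sgn k x (F.erase y) = if y < x then -sgn k x F else sgn k x F := by
  conv_rhs => rw [← Finset.insert_erase hy]
  rw [sgn_insert (Finset.notMem_erase y F)]
  split_ifs <;> simp

/-- Whichever of `c` and `x` is larger sees the smaller one appear or disappear below it, so exactly
one sign flips. This cancels the cross terms of the cone homotopy. -/
theorem sgn_mul_sgn_insert {c x : X} {F : Finset X} (hc : c ∉ F) (hx : x ∈ F) :
    sgn k c F * sgn k x (insert c F) = -(sgn k x F * sgn k c (F.erase x)) := by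
  have hne : c ≠ x := fun h => hc (h ▸ hx)
  rw [sgn_insert hc, sgn_erase hx]
  rcases lt_or_gt_of_ne hne with h | h
  · simp [h, not_lt_of_gt h, mul_comm]
  · simp [h, not_lt_of_gt h, mul_comm]

theorem sgn_mul_sgn_erase {x y : X} {F : Finset X} (hx : x ∈ F) (hy : y ∈ F) (hne : x ≠ y) :
    sgn k x F * sgn k y (F.erase x) = -(sgn k y F * sgn k x (F.erase y)) := by
  rw [sgn_erase hx, sgn_erase hy]
  rcases lt_or_gt_of_ne hne with h | h
  · simp [h, not_lt_of_gt h, mul_comm]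
  · simp [h, not_lt_of_gt h, mul_comm]

/-- The Koszul differential of the family of operators `y`. -/
noncomputable def koszul (y : X → N →ₗ[k] N) : (Finset X →₀ N) →ₗ[k] (Finset X →₀ N) :=
  Finsupp.lsum k fun F => ∑ x ∈ F, sgn k x F • (Finsupp.lsingle (F.erase x) ∘ₗ y x)

theorem koszul_single (y : X → N →ₗ[k] N) (F : Finset X) (n : N) :
    koszul y (Finsupp.single F n) =
      ∑ x ∈ F, sgn k x F • Finsupp.single (F.erase x) (y x n) := by
  simp [koszul]

theorem koszul_comp_self (y : X → N →ₗ[k] N) (hy : ∀ x z, y x ∘ₗ y z = y z ∘ₗ y x) :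
    koszul y ∘ₗ koszul y = 0 := by
  refine Finsupp.lhom_ext fun F n => ?_
  have hy' : ∀ x z n, y x (y z n) = y z (y x n) := fun x z n => LinearMap.congr_fun (hy x z) n
  simp only [LinearMap.comp_apply, koszul_single, map_sum, map_smul, Finset.smul_sum, smul_smul,
    LinearMap.zero_apply]
  rw [Finset.sum_sigma']
  -- Deleting `x` then `z` cancels against deleting `z` then `x`.
  refine Finset.sum_involution (fun p _ => ⟨p.2, p.1⟩) ?_ ?_ ?_ ?_
  · rintro ⟨x, z⟩ h
    simp only [Finset.mem_sigma, Finset.mem_erase] at h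
    dsimp only
    rw [sgn_mul_sgn_erase h.1 h.2.2 h.2.1.symm, Finset.erase_right_comm, hy' z x]
    simp
  · rintro ⟨x, z⟩ h - h'
    simp only [Finset.mem_sigma, Finset.mem_erase] at h
    simp only [Sigma.mk.injEq, heq_eq_eq] at h'
    exact h.2.1 h'.1
  · rintro ⟨x, z⟩ h
    simp only [Finset.mem_sigma, Finset.mem_erase] at h ⊢
    exact ⟨h.2.2, h.2.1.symm, h.1⟩
  · rintro ⟨x, z⟩ h
    rfl

theorem mapRange_comp_koszul (y : X → N →ₗ[k] N) (y' : X → N' →ₗ[k] N') (f : N →ₗ[k] N')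
    (hf : ∀ x, f ∘ₗ y x = y' x ∘ₗ f) :
    Finsupp.mapRange.linearMap f ∘ₗ koszul y = koszul y' ∘ₗ Finsupp.mapRange.linearMap f := by
  refine Finsupp.lhom_ext fun F n => ?_
  have hf' : ∀ x n, f (y x n) = y' x (f n) := fun x n => LinearMap.congr_fun (hf x) n
  simp [koszul_single, hf', -Finsupp.mapRange_apply]

/-- The cone operator with apex `c`, where `q` is a left inverse of the operator of `c`. -/
noncomputable def cone (c : X) (q : N →ₗ[k] N) : (Finset X →₀ N) →ₗ[k] (Finset X →₀ N) :=
  Finsupp.lsum k fun F =>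
    if c ∈ F then 0 else sgn k c F • (Finsupp.lsingle (insert c F) ∘ₗ q)

theorem cone_single_of_mem {c : X} (q : N →ₗ[k] N) {F : Finset X} (hc : c ∈ F) (n : N) :
    cone c q (Finsupp.single F n) = 0 := by
  simp [cone, hc]

theorem cone_single_of_notMem {c : X} (q : N →ₗ[k] N) {F : Finset X} (hc : c ∉ F) (n : N) :
    cone c q (Finsupp.single F n) = sgn k c F • Finsupp.single (insert c F) (q n) := by
  simp [cone, hc]

/-- The cone operator is a contracting homotopy up to the projection that kills `c`. -/
theorem koszul_cone_add_cone_koszul (y : X → N →ₗ[k] N) (c : X) (q : N →ₗ[k] N)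
    (hq : q ∘ₗ y c = LinearMap.id) (hqy : ∀ x ≠ c, q ∘ₗ y x = y x ∘ₗ q) (F : Finset X) (n : N) :
    koszul y (cone c q (Finsupp.single F n)) + cone c q (koszul y (Finsupp.single F n)) =
      if c ∈ F then Finsupp.single F n else Finsupp.single F (y c (q n)) := by
  have hq' : ∀ n, q (y c n) = n := fun n => LinearMap.congr_fun hq n
  split_ifs with hc
  · rw [cone_single_of_mem q hc, map_zero, zero_add, koszul_single, map_sum,
      Finset.sum_eq_single_of_mem c hc]
    · rw [map_smul, cone_single_of_notMem q (Finset.notMem_erase c F), smul_smul,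
        sgn_erase_self, sgn_mul_self, one_smul, Finset.insert_erase hc, hq']
    · intro x hx hxc
      rw [map_smul, cone_single_of_mem q (Finset.mem_erase.2 ⟨hxc.symm, hc⟩), smul_zero]
  · rw [cone_single_of_notMem q hc, map_smul, koszul_single, Finset.sum_insert hc, smul_add,
      smul_smul, sgn_insert_self, sgn_mul_self, one_smul, Finset.erase_insert hc, add_assoc,
      koszul_single, map_sum, Finset.smul_sum, ← Finset.sum_add_distrib,
      Finset.sum_eq_zero, add_zero]
    intro x hx
    have hne : x ≠ c := fun h => hc (h ▸ hx)
    have hqx : q (y x n) = y x (q n) := LinearMap.congr_fun (hqy x hne) n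
    rw [map_smul, cone_single_of_notMem q (fun h => hc (Finset.mem_of_mem_erase h)), smul_smul,
      smul_smul, sgn_mul_sgn_insert hc hx, hqx, Finset.erase_insert_of_ne hne.symm]
    simp

theorem boundary_eq_koszul : boundary k X = koszul fun _ => LinearMap.id := by
  refine Finsupp.lhom_ext fun F n => ?_
  simp only [boundary, Finsupp.linearCombination_single, koszul_single, Finset.smul_sum]
  refine Finset.sum_congr rfl fun x _ => ?_
  simp [sgn, mul_comm]

theorem boundary_comp_self : boundary k X ∘ₗ boundary k X = 0 := by
  rw [boundary_eq_koszul]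
  exact koszul_comp_self _ fun _ _ => rfl

theorem boundary_single (F : Finset X) (n : k) :
    boundary k X (Finsupp.single F n) = ∑ x ∈ F, sgn k x F • Finsupp.single (F.erase x) n := by
  rw [boundary_eq_koszul, koszul_single]; rfl

end Koszul

/-! ### Simplicial complexes -/

/-- Reduces a statement on chains to single simplices in their support; with `f` the identity it
shows that a chain lies in a submodule. -/
theorem map_mem_of_forall_single {k ι N M : Type*} [Field k] [AddCommGroup N] [Module k N]
    [AddCommGroup M] [Module k M] (f : (ι →₀ N) →ₗ[k] M) {Q : Submodule k M} {z : ι →₀ N}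
    (h : ∀ F, z F ≠ 0 → f (Finsupp.single F (z F)) ∈ Q) : f z ∈ Q := by
  rw [← Finsupp.sum_single z, Finsupp.sum, map_sum]
  exact sum_mem fun F hF => h F (Finsupp.mem_support_iff.1 hF)

section Simplicial

variable {k V Z : Type*} [Field k] [LinearOrder V] [LinearOrder Z]

theorem mem_chains {V : Type*} {Δ : LowerSet (Finset V)} {i : ℤ} {z : Finset V →₀ k} :
    z ∈ chains k Δ i ↔ ∀ F, z F ≠ 0 → F ∈ Δ ∧ (F.card : ℤ) = i + 1 := by
  simp [chains, Finsupp.mem_supported, Set.subset_def]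

theorem single_mem_chains {V : Type*} {Δ : LowerSet (Finset V)} {i : ℤ} {F : Finset V}
    (hF : F ∈ Δ) (hi : (F.card : ℤ) = i + 1) (n : k) : Finsupp.single F n ∈ chains k Δ i :=
  Finsupp.single_mem_supported k n ⟨hF, hi⟩

theorem boundary_mem_chains {Δ : LowerSet (Finset V)} {i j : ℤ} (hj : j = i + 1)
    {z : Finset V →₀ k} (hz : z ∈ chains k Δ j) : boundary k V z ∈ chains k Δ i := by
  subst hj
  rw [mem_chains] at hz
  refine map_mem_of_forall_single _ fun F hF => ?_
  rw [boundary_single]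
  refine sum_mem fun x hx => Submodule.smul_mem _ _ (single_mem_chains
    (Δ.lower (Finset.erase_subset x F) (hz F hF).1) ?_ _)
  have := (hz F hF).2
  rw [Finset.card_erase_of_mem hx]
  have := Finset.card_pos.2 ⟨x, hx⟩
  omega

theorem cone_mem_chains {Δ Δ' : LowerSet (Finset V)} {c : V} (h : ∀ H ∈ Δ, insert c H ∈ Δ') {i : ℤ}
    {z : Finset V →₀ k} (hz : z ∈ chains k Δ i) :
    cone c (LinearMap.id : k →ₗ[k] k) z ∈ chains k Δ' (i + 1) := by
  rw [mem_chains] at hz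
  refine map_mem_of_forall_single _ fun F hF => ?_
  by_cases hc : c ∈ F
  · rw [cone_single_of_mem _ hc]; exact zero_mem _
  · rw [cone_single_of_notMem _ hc]
    refine Submodule.smul_mem _ _ (single_mem_chains (h F (hz F hF).1) ?_ _)
    rw [Finset.card_insert_of_notMem hc]
    have := (hz F hF).2
    push_cast
    omega

/-- For identity operators both branches of the homotopy formula return the simplex itself, so no
case distinction on `c ∈ F` remains. -/
theorem boundary_cone (c : V) (z : Finset V →₀ k) :
    boundary k V (cone c (LinearMap.id : k →ₗ[k] k) z) = z - cone c (LinearMap.id : k →ₗ[k] k) (boundary k V z) := by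
  rw [eq_sub_iff_add_eq]
  have : boundary k V ∘ₗ cone c (LinearMap.id : k →ₗ[k] k) + cone c (LinearMap.id : k →ₗ[k] k) ∘ₗ boundary k V =
      LinearMap.id := by
    refine Finsupp.lhom_ext fun F n => ?_
    have := koszul_cone_add_cone_koszul (k := k) (fun _ : V => LinearMap.id) c
      (LinearMap.id : k →ₗ[k] k) rfl (fun _ _ => rfl) F n
    rw [← boundary_eq_koszul] at this
    simpa using this
  exact LinearMap.congr_fun this z

/-- Gluing a cone along a cone does not change the homology. -/
theorem reducedHomology_equiv_of_gluing_cone {Δ₀ K Δ : LowerSet (Finset V)} (h₀ : Δ₀ ≤ Δ)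
    (hK : K ≤ Δ) (hcover : ∀ H ∈ Δ, H ∈ Δ₀ ∨ H ∈ K) (c : V) (hc : ∀ H ∈ K, insert c H ∈ K)
    (hc₀ : ∀ H ∈ K, H ∈ Δ₀ → insert c H ∈ Δ₀) (i : ℤ) :
    Nonempty (ReducedHomology k Δ₀ i ≃ₗ[k] ReducedHomology k Δ i) := by
  classical
  refine homology_equiv_of_acyclic_quotient (A := chains k Δ₀) (X := chains k Δ) boundary_comp_self
    (fun i z hz => mem_chains.2 fun F hF => ⟨h₀ (mem_chains.1 hz F hF).1, (mem_chains.1 hz F hF).2⟩)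
    ?_ i
  intro i z hz hDz
  rw [mem_chains] at hz
  -- Excision: `z₁`, the part of `z` outside `Δ₀`, is supported on the cone `K`, and its boundary
  -- lies in `Δ₀ ⊓ K`.
  set z₀ := z.filter (· ∈ Δ₀) with hz₀
  set z₁ := z.filter (· ∉ Δ₀) with hz₁
  have hsum : z₀ + z₁ = z := Finsupp.filter_add_filter_not z _
  have hz₀mem : z₀ ∈ chains k Δ₀ (i + 1) := by
    rw [mem_chains]
    intro F hF
    rw [hz₀, Finsupp.filter_apply] at hF
    split_ifs at hF with h
    · exact ⟨h, (hz F hF).2⟩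
    · exact absurd rfl hF
  have hz₁mem : z₁ ∈ chains k K (i + 1) := by
    rw [mem_chains]
    intro F hF
    rw [hz₁, Finsupp.filter_apply] at hF
    split_ifs at hF with h
    · exact absurd rfl hF
    · exact ⟨(hcover F (hz F hF).1).resolve_left h, (hz F hF).2⟩
  have hD₁ : boundary k V z₁ ∈ chains k (Δ₀ ⊓ K) i := by
    rw [mem_chains]
    intro F hF
    have h1 := boundary_mem_chains rfl hz₁mem
    have h2 : boundary k V z₁ ∈ chains k Δ₀ i := by
      have : boundary k V z₁ = boundary k V z - boundary k V z₀ := by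
        rw [← hsum, map_add, add_sub_cancel_left]
      rw [this]
      exact sub_mem hDz (boundary_mem_chains rfl hz₀mem)
    exact ⟨⟨(mem_chains.1 h2 F hF).1, (mem_chains.1 h1 F hF).1⟩, (mem_chains.1 h1 F hF).2⟩
  -- Coning off `z₁` replaces it by the cone over its boundary, which stays in `Δ₀` because `Δ₀ ⊓ K`
  -- is coned into `Δ₀`.
  refine ⟨cone c (LinearMap.id : k →ₗ[k] k) z₁, cone_mem_chains (fun H hH => hK (hc H hH)) hz₁mem, ?_⟩
  have : z - boundary k V (cone c (LinearMap.id : k →ₗ[k] k) z₁) =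
      z₀ + cone c (LinearMap.id : k →ₗ[k] k) (boundary k V z₁) := by
    rw [boundary_cone, ← hsum]; abel
  rw [this]
  exact add_mem hz₀mem (cone_mem_chains (Δ := Δ₀ ⊓ K) (fun H hH => hc₀ H hH.2 hH.1) hD₁)

/-- If the faces with a given nonempty `L`-part form a cone with apex outside `L`, then the faces
outside `L` carry all the homology. -/
theorem reducedHomology_equiv_of_part_cone {Δ Δ₀ : LowerSet (Finset V)} (L : V → Prop)
    [DecidablePred L] (hfin : {F | F ∈ Δ ∧ ∀ x ∈ F, L x}.Finite)
    (hc : ∀ F ∈ Δ, F.Nonempty → (∀ x ∈ F, L x) →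
      ∃ c, ¬ L c ∧ ∀ H ∈ Δ, H.filter L = F → insert c H ∈ Δ)
    (h₀ : ∀ H, H ∈ Δ₀ ↔ H ∈ Δ ∧ H.filter L = ∅) (i : ℤ) :
    Nonempty (ReducedHomology k Δ₀ i ≃ₗ[k] ReducedHomology k Δ i) := by
  classical
  -- Induction on the set `𝓕` of nonempty `L`-parts that are allowed: empty `𝓕` gives `Δ₀`, all of
  -- them give `Δ`.
  have key : ∀ (n : ℕ) (𝓕 : Finset (Finset V)), 𝓕.card = n →
      (∀ F ∈ 𝓕, F ∈ Δ ∧ F.Nonempty ∧ ∀ x ∈ F, L x) →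
      (∀ F ∈ 𝓕, ∀ G ⊆ F, G.Nonempty → G ∈ 𝓕) → ∀ Δ' : LowerSet (Finset V),
      (∀ H, H ∈ Δ' ↔ H ∈ Δ ∧ (H.filter L = ∅ ∨ H.filter L ∈ 𝓕)) →
      Nonempty (ReducedHomology k Δ₀ i ≃ₗ[k] ReducedHomology k Δ' i) := by
    intro n
    induction n with
    | zero =>
      intro 𝓕 h𝓕 _ _ Δ' hΔ'
      rw [Finset.card_eq_zero] at h𝓕
      have : Δ' = Δ₀ := by
        ext H
        rw [SetLike.mem_coe, SetLike.mem_coe, hΔ', h₀, h𝓕]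
        simp
      rw [this]
      exact ⟨LinearEquiv.refl _ _⟩
    | succ n ih =>
      intro 𝓕 hcard h𝓕 hlow Δ' hΔ'
      -- An `F` of largest size can be removed with `𝓕` remaining closed under nonempty subsets.
      obtain ⟨F, hF, hmax⟩ := Finset.exists_max_image 𝓕 Finset.card
        (Finset.card_pos.1 (by omega))
      obtain ⟨hFΔ, hFne, hFL⟩ := h𝓕 F hF
      obtain ⟨c, hcL, hcΔ⟩ := hc F hFΔ hFne hFL
      have hfc : ∀ H : Finset V, (insert c H).filter L = H.filter L := fun H => by
        rw [Finset.filter_insert, if_neg hcL]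
      have hlow' : ∀ G ∈ 𝓕.erase F, ∀ G' ⊆ G, G'.Nonempty → G' ∈ 𝓕.erase F := by
        intro G hG G' hG' hne
        rw [Finset.mem_erase] at hG ⊢
        refine ⟨?_, hlow G hG.2 G' hG' hne⟩
        rintro rfl
        exact hG.1 (Finset.eq_of_subset_of_card_le hG' (hmax G hG.2)).symm
      let Δ'' : LowerSet (Finset V) :=
        { carrier := {H | H ∈ Δ ∧ (H.filter L = ∅ ∨ H.filter L ∈ 𝓕.erase F)}
          lower' := by
            rintro H H' hle ⟨hH, hH'⟩
            refine ⟨Δ.lower hle hH, ?_⟩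
            have hsub : H'.filter L ⊆ H.filter L := Finset.filter_subset_filter L hle
            rcases hH' with hH' | hH'
            · exact Or.inl (Finset.subset_empty.1 (hH' ▸ hsub))
            · rcases Finset.eq_empty_or_nonempty (H'.filter L) with h | h
              · exact Or.inl h
              · exact Or.inr (hlow' _ hH' _ hsub h) }
      have hΔ'' : ∀ H, H ∈ Δ'' ↔ H ∈ Δ ∧ (H.filter L = ∅ ∨ H.filter L ∈ 𝓕.erase F) :=
        fun _ => Iff.rfl
      obtain ⟨e⟩ := ih (𝓕.erase F) (by rw [Finset.card_erase_of_mem hF]; omega)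
        (fun G hG => h𝓕 G (Finset.mem_of_mem_erase hG)) hlow' Δ'' hΔ''
      -- A cone with apex `c` that contains every face with `L`-part `F`. Since `c` lies outside
      -- `L`, adding it never changes an `L`-part.
      let K : LowerSet (Finset V) :=
        { carrier := {H | H.filter L ⊆ F ∧ insert c H ∈ Δ}
          lower' := fun H H' hle hH => ⟨(Finset.filter_subset_filter L hle).trans hH.1,
            Δ.lower (Finset.insert_subset_insert c hle) hH.2⟩ }
      have hK : ∀ H, H ∈ K ↔ H.filter L ⊆ F ∧ insert c H ∈ Δ := fun _ => Iff.rfl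
      obtain ⟨e'⟩ := reducedHomology_equiv_of_gluing_cone (k := k) (Δ₀ := Δ'') (K := K) (Δ := Δ')
        (fun H hH => (hΔ' H).2 ⟨hH.1, hH.2.imp_right Finset.mem_of_mem_erase⟩)
        (fun H hH => by
          refine (hΔ' H).2 ⟨Δ.lower (Finset.subset_insert c H) hH.2, ?_⟩
          rcases Finset.eq_empty_or_nonempty (H.filter L) with h | h
          · exact Or.inl h
          · exact Or.inr (hlow F hF _ hH.1 h))
        (fun H hH => by
          rw [hΔ'] at hH
          rw [hΔ'', hK]
          by_cases h : H.filter L = F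
          · exact Or.inr ⟨h.subset, hcΔ H hH.1 h⟩
          · exact Or.inl ⟨hH.1, hH.2.imp_right fun h' => Finset.mem_erase.2 ⟨h, h'⟩⟩)
        c (fun H hH => ⟨by rw [hfc]; exact hH.1, by rw [Finset.insert_idem]; exact hH.2⟩)
        (fun H hH hH' => ⟨hH.2, by rw [hfc]; exact hH'.2⟩) i
      exact ⟨e.trans e'⟩
  refine key _ (hfin.toFinset.filter Finset.Nonempty) rfl ?_ ?_ Δ ?_
  · intro F hF
    simp only [Finset.mem_filter, Set.Finite.mem_toFinset, Set.mem_ofPred_eq] at hF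
    exact ⟨hF.1.1, hF.2, hF.1.2⟩
  · intro F hF G hG hne
    simp only [Finset.mem_filter, Set.Finite.mem_toFinset, Set.mem_ofPred_eq] at hF ⊢
    exact ⟨⟨Δ.lower hG hF.1.1, fun x hx => hF.1.2 x (hG hx)⟩, hne⟩
  · intro H
    simp only [Finset.mem_filter, Set.Finite.mem_toFinset, Set.mem_ofPred_eq]
    refine ⟨fun h => ⟨h, ?_⟩, fun h => h.1⟩
    rcases Finset.eq_empty_or_nonempty (H.filter L) with h' | h'
    · exact Or.inl h'
    · exact Or.inr ⟨⟨Δ.lower (Finset.filter_subset L H) h, fun x hx => hx.2⟩, h'⟩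

theorem sgn_map (e : V ↪o Z) (x : V) (F : Finset V) :
    sgn k (e x) (F.map e.toEmbedding) = sgn k x F := by
  unfold sgn
  rw [Finset.filter_map, Finset.card_map]
  congr 2
  ext y
  simp

/-- Preserving the order of the vertices preserves the signs, so pushing simplices forward is a
chain map, bijective onto the chains of the image complex. -/
theorem reducedHomology_equiv_of_orderEmbedding (e : V ↪o Z) {Δ : LowerSet (Finset V)}
    {Δ' : LowerSet (Finset Z)} (h : ∀ H, H ∈ Δ' ↔ ∃ F ∈ Δ, F.map e.toEmbedding = H) (i : ℤ) :
    Nonempty (ReducedHomology k Δ i ≃ₗ[k] ReducedHomology k Δ' i) := by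
  let f : (Finset V →₀ k) →ₗ[k] (Finset Z →₀ k) :=
    Finsupp.lmapDomain k k (Finset.map e.toEmbedding)
  have hf : ∀ F n, f (Finsupp.single F n) = Finsupp.single (F.map e.toEmbedding) n := fun F n =>
    Finsupp.mapDomain_single
  have hinj : Function.Injective f :=
    Finsupp.mapDomain_injective (Finset.map_injective e.toEmbedding)
  have hmap : ∀ i, (chains k Δ i).map f = chains k Δ' i := by
    intro i
    apply le_antisymm
    · rintro _ ⟨z, hz, rfl⟩
      refine map_mem_of_forall_single f fun F hF => ?_
      have := mem_chains.1 hz F hF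
      rw [hf]
      exact single_mem_chains ((h _).2 ⟨F, this.1, rfl⟩) (by simpa using this.2) _
    · intro z hz
      refine map_mem_of_forall_single LinearMap.id fun H hH => ?_
      obtain ⟨h1, h2⟩ := mem_chains.1 hz H hH
      obtain ⟨F, hF, hFH⟩ := (h H).1 h1
      refine ⟨Finsupp.single F (z H), single_mem_chains hF ?_ _, ?_⟩
      · rw [← h2, ← hFH, Finset.card_map]
      · rw [hf, hFH]; rfl
  refine homology_equiv_of_bijective f ?_ (fun z hz => boundary_mem_chains rfl hz) (hmap _) (hmap _)
    (fun z _ hz => hinj (hz.trans (map_zero f).symm))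
    (fun z _ hz => hinj (hz.trans (map_zero f).symm))
    (fun z hz => boundary_mem_chains (by ring) hz)
  refine Finsupp.lhom_ext fun F n => ?_
  simp only [LinearMap.comp_apply, boundary_single, map_sum, map_smul, hf, Finset.sum_map]
  refine Finset.sum_congr rfl fun x _ => ?_
  have h1 : e.toEmbedding x = e x := rfl
  rw [Finset.map_erase, h1, sgn_map]

end Simplicial

/-! ### Dowker duality -/

section Dowker

variable {k X Y Z : Type*} [Field k] [LinearOrder X] [LinearOrder Y] [LinearOrder Z]

/-- One half of the duality. A face with nonempty `X`-part `F` may be enlarged by any `y` related to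
all of `F`, so only the faces inside `Y` contribute. The vertex type `Z` is abstract so that the
same complex serves with the roles of `X` and `Y` exchanged. -/
theorem reducedHomology_equiv_join {R : X → Y → Prop} {Δ₁ : LowerSet (Finset X)}
    {Δ₂ : LowerSet (Finset Y)} (hfin : (Δ₁ : Set (Finset X)).Finite) (h₁e : ∅ ∈ Δ₁)
    (h₁ : ∀ F ∈ Δ₁, F.Nonempty → ∃ y, ∀ x ∈ F, R x y)
    (h₂ : ∀ G : Finset Y, (∃ x, ∀ y ∈ G, R x y) → G ∈ Δ₂)
    (e₁ : X ↪o Z) (e₂ : Y ↪o Z) (hne : ∀ x y, e₁ x ≠ e₂ y)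
    (hcov : ∀ z, (∃ x, e₁ x = z) ∨ ∃ y, e₂ y = z) {Δ : LowerSet (Finset Z)}
    (hΔ : ∀ H, H ∈ Δ ↔ H.preimage e₁ e₁.injective.injOn ∈ Δ₁ ∧
      H.preimage e₂ e₂.injective.injOn ∈ Δ₂ ∧ ∀ x y, e₁ x ∈ H → e₂ y ∈ H → R x y) (i : ℤ) :
    Nonempty (ReducedHomology k Δ₂ i ≃ₗ[k] ReducedHomology k Δ i) := by
  classical
  let L : Z → Prop := fun z => ∃ x, e₁ x = z
  have hL : ∀ y, ¬ L (e₂ y) := fun y ⟨x, hx⟩ => hne x y hx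
  let Δ₀ : LowerSet (Finset Z) :=
    { carrier := {H | H ∈ Δ ∧ H.filter L = ∅}
      lower' := fun H H' hle hH => ⟨Δ.lower hle hH.1,
        Finset.subset_empty.1 (hH.2 ▸ Finset.filter_subset_filter L hle)⟩ }
  have h₀ : ∀ H, H ∈ Δ₀ ↔ ∃ G ∈ Δ₂, G.map e₂.toEmbedding = H := by
    intro H
    constructor
    · rintro ⟨hH, hH'⟩
      refine ⟨_, ((hΔ H).1 hH).2.1, ?_⟩
      ext z
      simp only [Finset.mem_map, Finset.mem_preimage]
      constructor
      · rintro ⟨y, hy, rfl⟩; exact hy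
      · intro hz
        rcases hcov z with ⟨x, rfl⟩ | ⟨y, rfl⟩
        · exact absurd (Finset.mem_filter.2 ⟨hz, x, rfl⟩) (hH' ▸ Finset.notMem_empty _)
        · exact ⟨y, hz, rfl⟩
    · rintro ⟨G, hG, rfl⟩
      have hx : ∀ x, e₁ x ∉ G.map e₂.toEmbedding := by
        intro x hx
        obtain ⟨y, -, hy⟩ := Finset.mem_map.1 hx
        exact hne x y hy.symm
      refine ⟨(hΔ _).2 ⟨?_, ?_, fun x y h => absurd h (hx x)⟩, ?_⟩
      · convert h₁e
        ext x
        simpa using hx x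
      · convert hG
        ext y
        simp
      · ext z
        simp only [Finset.mem_filter, Finset.notMem_empty, iff_false]
        rintro ⟨hz, x, rfl⟩
        exact hx x hz
  obtain ⟨e⟩ := reducedHomology_equiv_of_orderEmbedding (k := k) e₂ h₀ i
  suffices h : Nonempty (ReducedHomology k Δ₀ i ≃ₗ[k] ReducedHomology k Δ i) from
    h.elim fun e' => ⟨e.trans e'⟩
  refine reducedHomology_equiv_of_part_cone L ?_ ?_ (fun _ => Iff.rfl) i
  · refine (hfin.image (Finset.map e₁.toEmbedding)).subset ?_
    rintro H ⟨hH, hH'⟩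
    refine ⟨_, ((hΔ H).1 hH).1, ?_⟩
    ext z
    simp only [Finset.mem_map, Finset.mem_preimage]
    constructor
    · rintro ⟨y, hy, rfl⟩; exact hy
    · intro hz
      obtain ⟨x, rfl⟩ := hH' z hz
      exact ⟨x, hz, rfl⟩
  · intro F hF hFne hFL
    obtain ⟨z, hz⟩ := hFne
    obtain ⟨x₀, rfl⟩ := hFL z hz
    obtain ⟨y, hy⟩ := h₁ _ ((hΔ F).1 hF).1 ⟨x₀, Finset.mem_preimage.2 hz⟩
    refine ⟨e₂ y, hL y, ?_⟩
    rintro H hH rfl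
    have hy' : ∀ x, e₁ x ∈ H → R x y := fun x hx =>
      hy x (Finset.mem_preimage.2 (Finset.mem_filter.2 ⟨hx, x, rfl⟩))
    have hx₀ : e₁ x₀ ∈ H := (Finset.mem_filter.1 hz).1
    obtain ⟨hH1, hH2, hH3⟩ := (hΔ H).1 hH
    have hrel : ∀ x y', e₁ x ∈ insert (e₂ y) H → e₂ y' ∈ insert (e₂ y) H → R x y' := by
      intro x y' hx hy''
      have hx' := (Finset.mem_insert.1 hx).resolve_left (hne x y)
      rcases Finset.mem_insert.1 hy'' with h | h
      · rw [e₂.injective h]; exact hy' x hx'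
      · exact hH3 x y' hx' h
    -- The enlarged `Y`-part is still a face of `Δ₂` because `x₀` is related to all of it; this is
    -- where `F` must be nonempty.
    refine (hΔ _).2 ⟨?_, h₂ _ ⟨x₀, fun y' h => ?_⟩, hrel⟩
    · convert hH1 using 1
      ext x
      simp [hne]
    · exact hrel x₀ y' (Finset.mem_insert_of_mem hx₀) (Finset.mem_preimage.1 h)

/-- Dowker duality: the two simplicial complexes of a relation have the same homology. -/
theorem dowker {R : X → Y → Prop} {Δ₁ : LowerSet (Finset X)} {Δ₂ : LowerSet (Finset Y)}
    (hfin₁ : (Δ₁ : Set (Finset X)).Finite) (hfin₂ : (Δ₂ : Set (Finset Y)).Finite)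
    (h₁e : ∅ ∈ Δ₁) (h₂e : ∅ ∈ Δ₂)
    (h₁ : ∀ F : Finset X, F.Nonempty → (F ∈ Δ₁ ↔ ∃ y, ∀ x ∈ F, R x y))
    (h₂ : ∀ G : Finset Y, G.Nonempty → (G ∈ Δ₂ ↔ ∃ x, ∀ y ∈ G, R x y)) (i : ℤ) :
    Nonempty (ReducedHomology k Δ₂ i ≃ₗ[k] ReducedHomology k Δ₁ i) := by
  classical
  let e₁ : X ↪o Lex (X ⊕ Y) := OrderEmbedding.ofMapLEIff (fun x => toLex (Sum.inl x))
    fun a b => Sum.Lex.inl_le_inl_iff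
  let e₂ : Y ↪o Lex (X ⊕ Y) := OrderEmbedding.ofMapLEIff (fun x => toLex (Sum.inr x))
    fun a b => Sum.Lex.inr_le_inr_iff
  have hne : ∀ x y, e₁ x ≠ e₂ y := fun x y h => by
    have : (Sum.inl x : X ⊕ Y) = Sum.inr y := h
    simp at this
  have hcov : ∀ z, (∃ x, e₁ x = z) ∨ ∃ y, e₂ y = z := by
    intro z
    rcases hz : ofLex z with x | y
    · exact Or.inl ⟨x, hz.symm⟩
    · exact Or.inr ⟨y, hz.symm⟩
  let Δ : LowerSet (Finset (Lex (X ⊕ Y))) :=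
    { carrier := {H | H.preimage e₁ e₁.injective.injOn ∈ Δ₁ ∧
        H.preimage e₂ e₂.injective.injOn ∈ Δ₂ ∧ ∀ x y, e₁ x ∈ H → e₂ y ∈ H → R x y}
      lower' := fun H H' hle hH => ⟨Δ₁.lower (fun x hx => Finset.mem_preimage.2
          (hle (Finset.mem_preimage.1 hx))) hH.1, Δ₂.lower (fun x hx => Finset.mem_preimage.2
          (hle (Finset.mem_preimage.1 hx))) hH.2.1,
        fun x y hx hy => hH.2.2 x y (hle hx) (hle hy)⟩ }
  obtain ⟨e⟩ := reducedHomology_equiv_join (k := k) (R := R) (Δ := Δ) hfin₁ h₁e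
    (fun F hF hne => (h₁ F hne).1 hF)
    (fun G hG => G.eq_empty_or_nonempty.elim (fun h => h ▸ h₂e) fun h => (h₂ G h).2 hG)
    e₁ e₂ hne hcov (fun _ => Iff.rfl) i
  obtain ⟨e'⟩ := reducedHomology_equiv_join (k := k) (R := fun y x => R x y) (Δ := Δ) hfin₂ h₂e
    (fun F hF hne => (h₂ F hne).1 hF)
    (fun G hG => G.eq_empty_or_nonempty.elim (fun h => h ▸ h₁e) fun h => (h₁ G h).2 hG)
    e₂ e₁ (fun y x h => hne x y h.symm) (fun z => (hcov z).symm)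
    (fun H => ⟨fun h => ⟨h.2.1, h.1, fun y x hy hx => h.2.2 x y hx hy⟩,
      fun h => ⟨h.2.1, h.1, fun x y hx hy => h.2.2 y x hy hx⟩⟩) i
  exact ⟨e.trans e'.symm⟩

end Dowker

/-! ### Factorizations and standard monomials -/

section Factorizations

variable {d r s : ℕ} {A : Fin r ⊕ Fin s → Fin d → ℤ}

theorem degA_add (m m' : Fin r ⊕ Fin s →₀ ℕ) : degA A (m + m') = degA A m + degA A m' := by
  simp [degA, add_smul, Finset.sum_add_distrib]

theorem degA_single (x : Fin r ⊕ Fin s) (n : ℕ) : degA A (Finsupp.single x n) = n • gen A x := by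
  rw [degA, Finset.sum_eq_single x]
  · simp
  · intro y _ hy
    simp [hy.symm]
  · simp

theorem degA_sum_single (F : Finset (Fin r)) :
    degA A (∑ i ∈ F, Finsupp.single (Sum.inl i) 1) = ∑ i ∈ F, gen A (Sum.inl i) := by
  classical
  induction F using Finset.induction_on with
  | empty => simp [degA]
  | insert x F hx ih =>
    rw [Finset.sum_insert hx, degA_add, ih, Finset.sum_insert hx, degA_single, one_smul]

theorem degA_surjective : Function.Surjective (degA A) := by
  rintro ⟨b, hb⟩
  suffices h : ∃ m, (degA A m : Fin d → ℤ) = b from h.imp fun m hm => Subtype.ext hm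
  refine AddSubmonoid.closure_induction (motive := fun b _ => ∃ m, (degA A m : Fin d → ℤ) = b)
    ?_ ?_ ?_ hb
  · rintro _ ⟨x, rfl⟩
    exact ⟨Finsupp.single x 1, by rw [degA_single, one_smul]; rfl⟩
  · exact ⟨0, by simp [degA]⟩
  · rintro _ _ _ _ ⟨m, rfl⟩ ⟨m', rfl⟩
    exact ⟨m + m', by rw [degA_add]; rfl⟩

theorem coe_degA (m : Fin r ⊕ Fin s →₀ ℕ) : (degA A m : Fin d → ℤ) = ∑ x, m x • A x := by
  simp [degA, gen]

theorem eq_zero_of_degA_eq_zero (hA : FiniteFactorizations A) {m : Fin r ⊕ Fin s →₀ ℕ}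
    (h : degA A m = 0) : m = 0 := by
  have := hA m (by rw [← coe_degA, h]; rfl)
  exact DFunLike.coe_injective this

/-- Two comparable factorizations of `a` differ by a factorization of `0`, hence coincide; an
antichain in `ℕⁿ` is finite by Dickson's lemma. -/
theorem finite_factorizations (hA : FiniteFactorizations A) (a : semigroup A) :
    {m | degA A m = a}.Finite := by
  have hanti : IsAntichain (· ≤ ·) {m | degA A m = a} := by
    intro m hm m' hm' hne hle
    obtain ⟨c, rfl⟩ := exists_add_of_le hle
    have h1 : degA A m = a := hm
    have h2 : degA A (m + c) = a := hm'
    rw [degA_add, h1] at h2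
    have : degA A c = 0 := by
      apply Subtype.ext
      have := congrArg (fun x : semigroup A => (x : Fin d → ℤ)) h2
      simpa using this
    rw [eq_zero_of_degA_eq_zero hA this] at hne
    exact hne (by simp)
  exact hanti.finite_of_partiallyWellOrderedOn
    (Set.PartiallyWellOrderedOn.mono (Set.isPWO_of_wellQuasiOrderedLE _) (Set.subset_univ _))

theorem mem_T {a : semigroup A} {F : Finset (Fin r)} :
    F ∈ T A a ↔ ∃ b : semigroup A, b + ∑ i ∈ F, gen A (Sum.inl i) = a := by
  have hcoe : ((∑ i ∈ F, gen A (Sum.inl i) : semigroup A) : Fin d → ℤ) =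
      ∑ i ∈ F, A (Sum.inl i) := by simp [gen]
  constructor
  · intro h
    refine ⟨⟨_, h⟩, Subtype.ext ?_⟩
    rw [AddSubmonoid.coe_add, hcoe]
    exact sub_add_cancel _ _
  · rintro ⟨b, rfl⟩
    change ((b + ∑ i ∈ F, gen A (Sum.inl i) : semigroup A) : Fin d → ℤ) -
      ∑ i ∈ F, A (Sum.inl i) ∈ semigroup A
    rw [AddSubmonoid.coe_add, hcoe, add_sub_cancel_right]
    exact b.2

/-! ### The reverse lexicographic order -/

theorem Revlex.trans {ρ : Fin r ⊕ Fin s → ℕ} (hρ : Function.Injective ρ)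
    {m₁ m₂ m₃ : Fin r ⊕ Fin s →₀ ℕ} (h : Revlex ρ m₁ m₂) (h' : Revlex ρ m₂ m₃) :
    Revlex ρ m₁ m₃ := by
  obtain ⟨x, hx, hx'⟩ := h
  obtain ⟨y, hy, hy'⟩ := h'
  rcases lt_trichotomy (ρ x) (ρ y) with hlt | heq | hlt
  · exact ⟨x, hy' x hlt ▸ hx, fun z hz => (hx' z hz).trans (hy' z (hz.trans hlt))⟩
  · obtain rfl := hρ heq
    exact ⟨x, hy.trans hx, fun z hz => (hx' z hz).trans (hy' z hz)⟩
  · exact ⟨y, (hx' y hlt).symm ▸ hy, fun z hz => (hx' z (hz.trans hlt)).trans (hy' z hz)⟩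

theorem Revlex.irrefl {ρ : Fin r ⊕ Fin s → ℕ} (m : Fin r ⊕ Fin s →₀ ℕ) : ¬ Revlex ρ m m :=
  fun ⟨_, hx, _⟩ => lt_irrefl _ hx

theorem Revlex.add_right {ρ : Fin r ⊕ Fin s → ℕ} {m m' : Fin r ⊕ Fin s →₀ ℕ}
    (h : Revlex ρ m' m) (c : Fin r ⊕ Fin s →₀ ℕ) : Revlex ρ (m' + c) (m + c) := by
  obtain ⟨x, hx, hx'⟩ := h
  exact ⟨x, by simpa using hx, fun y hy => by simp [hx' y hy]⟩

/-- The powers of one variable descend forever under `Revlex`, so minimal elements are sought only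
in finite sets, such as the fibres of `degA`. -/
theorem exists_revlex_minimal {ρ : Fin r ⊕ Fin s → ℕ} (hρ : Function.Injective ρ)
    {M : Set (Fin r ⊕ Fin s →₀ ℕ)} (hM : M.Finite) (hne : M.Nonempty) :
    ∃ m ∈ M, ∀ m' ∈ M, ¬ Revlex ρ m' m := by
  have : IsTrans _ (Revlex ρ) := ⟨fun _ _ _ h h' => h.trans hρ h'⟩
  have : Std.Irrefl (Revlex ρ) := ⟨Revlex.irrefl⟩
  have : IsStrictOrder _ (Revlex ρ) := { }
  obtain ⟨⟨m, hm⟩, -, h⟩ := WellFounded.has_min (hM.wellFoundedOn (r := Revlex ρ)) Set.univ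
    ⟨⟨_, hne.some_mem⟩, trivial⟩
  exact ⟨m, hm, fun m' hm' => h ⟨m', hm'⟩ trivial⟩

/-! ### The toric ideal, standard `Z`-parts and the comparison of `Γ` with `T` -/

variable {k : Type*} [Field k]

theorem phiA_monomial (m : Fin r ⊕ Fin s →₀ ℕ) (c : k) :
    phiA A k (MvPolynomial.monomial m c) = AddMonoidAlgebra.single (degA A m) c := by
  rw [phiA, MvPolynomial.aeval_monomial, Finsupp.prod_fintype _ _ (by simp)]
  simp only [AddMonoidAlgebra.single_pow, one_pow]
  have : ∀ t : Finset (Fin r ⊕ Fin s), ∏ x ∈ t,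
      (AddMonoidAlgebra.single (m x • gen A x) 1 : AddMonoidAlgebra k (semigroup A)) =
      AddMonoidAlgebra.single (∑ x ∈ t, m x • gen A x) 1 := by
    intro t
    induction t using Finset.induction_on with
    | empty => simp [AddMonoidAlgebra.one_def]
    | insert x t hx ih =>
      rw [Finset.prod_insert hx, ih, AddMonoidAlgebra.single_mul_single, Finset.sum_insert hx,
        one_mul]
  rw [this, AddMonoidAlgebra.coe_algebraMap]
  simp [AddMonoidAlgebra.single_mul_single, degA]

/-- An element of the toric ideal has a second monomial of the same degree. -/
theorem exists_ne_mem_support_degA_eq {f : MvPolynomial (Fin r ⊕ Fin s) k}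
    (hf : f ∈ toricIdeal A k) {m : Fin r ⊕ Fin s →₀ ℕ} (hm : m ∈ f.support) :
    ∃ m' ∈ f.support, m' ≠ m ∧ degA A m' = degA A m := by
  by_contra! h
  have h0 : phiA A k f = 0 := hf
  rw [f.as_sum, map_sum] at h0
  have h1 := congrArg (fun p : AddMonoidAlgebra k (semigroup A) => p.coeff (degA A m)) h0
  simp only [phiA_monomial, AddMonoidAlgebra.coeff_sum, AddMonoidAlgebra.coeff_single,
    Finsupp.finsetSum_apply, AddMonoidAlgebra.coeff_zero, Finsupp.zero_apply] at h1
  rw [Finset.sum_eq_single_of_mem m hm fun m' hm' hne => Finsupp.single_eq_of_ne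
    (h m' hm' hne).symm, Finsupp.single_eq_same] at h1
  exact MvPolynomial.mem_support_iff.1 hm h1

/-- Every factorization can be changed, increasing the `Y`-part, so that the `Z`-part is
standard. -/
theorem exists_le_standard (hA : FiniteFactorizations A) {ρ : Fin r ⊕ Fin s → ℕ}
    (hρ : Function.Injective ρ) (m : Fin r ⊕ Fin s →₀ ℕ) :
    ∃ (v : Fin r →₀ ℕ) (u : Fin s →₀ ℕ), (∀ i, m (Sum.inl i) ≤ v i) ∧ u ∈ Q A ρ k ∧
      degA A (Finsupp.sumElim v u) = degA A m := by
  obtain ⟨m₀, ⟨hm₀, hm₀'⟩, hmin⟩ := exists_revlex_minimal hρ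
    (M := {m' | degA A m' = degA A m ∧ ∀ i, m (Sum.inl i) ≤ m' (Sum.inl i)})
    ((finite_factorizations hA (degA A m)).subset fun _ h => h.1) ⟨m, rfl, fun _ => le_rfl⟩
  let v : Fin r →₀ ℕ := Finsupp.comapDomain Sum.inl m₀ Sum.inl_injective.injOn
  let u : Fin s →₀ ℕ := Finsupp.comapDomain Sum.inr m₀ Sum.inr_injective.injOn
  have hvu : Finsupp.sumElim v u = Finsupp.sumElim v 0 + Finsupp.sumElim 0 u := by
    ext (i | j) <;> simp
  have hm₀vu : Finsupp.sumElim v u = m₀ := by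
    ext (i | j) <;> simp [v, u]
  refine ⟨v, u, hm₀', ?_, by rw [hm₀vu, hm₀]⟩
  intro hu
  have himage : initialIdeal A ρ k = Ideal.span ((fun m => MvPolynomial.monomial m (1 : k)) ''
      {m | ∃ f ∈ toricIdeal A k, m ∈ f.support ∧ ∀ m' ∈ f.support, m' ≠ m → Prec A ρ m' m}) := by
    unfold initialIdeal
    congr 1
    ext g
    constructor
    · rintro ⟨f, hf, m, hm, hm', rfl⟩
      exact ⟨m, ⟨f, hf, hm, hm'⟩, rfl⟩
    · rintro ⟨m, ⟨f, hf, hm, hm'⟩, rfl⟩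
      exact ⟨f, hf, m, hm, hm', rfl⟩
  -- The initial ideal is monomial, so a nonstandard `Z^u` is divisible by the leading monomial `m₁`
  -- of some `f`.
  rw [himage, MvPolynomial.mem_ideal_span_monomial_image] at hu
  obtain ⟨m₁, ⟨f, hf, hm₁, hlead⟩, hle⟩ := hu (Finsupp.sumElim 0 u) (by
    classical
    rw [MvPolynomial.support_monomial, if_neg one_ne_zero]; simp)
  obtain ⟨m₂, hm₂, hne, hdeg⟩ := exists_ne_mem_support_degA_eq hf hm₁
  have hrev : Revlex ρ m₂ m₁ := by
    rcases hlead m₂ hm₂ hne with ⟨l, hl, -⟩ | h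
    · rw [hdeg] at hl; exact absurd hl (lt_irrefl _)
    · exact h.2
  obtain ⟨c, hc⟩ := exists_add_of_le hle
  have hm₀eq : m₀ = m₁ + (c + Finsupp.sumElim v 0) := by
    rw [← add_assoc, ← hc, add_comm, ← hvu, hm₀vu]
  -- Exchanging `m₁` for `m₂` keeps the factor `Y^v`, so the new factorization still competes with
  -- `m₀` and is smaller.
  refine hmin (m₂ + (c + Finsupp.sumElim v 0)) ⟨?_, fun i => ?_⟩ ?_
  · rw [degA_add, hdeg, ← degA_add, ← hm₀eq, hm₀]
  · have := hm₀' i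
    simp only [Finsupp.add_apply, Finsupp.sumElim_inl]
    have h3 : v i = m₀ (Sum.inl i) := rfl
    omega
  · conv_rhs => rw [hm₀eq]
    exact hrev.add_right _

/-- A gcd differs from `1` when some variable divides every monomial; this puts `Γ` in the form
required by `dowker`. -/
theorem mem_Γ {ρ : Fin r ⊕ Fin s → ℕ} {a : semigroup A} {G : Finset (Lex (Fin r →₀ ℕ))}
    (hG : G.Nonempty) :
    G ∈ Γ A ρ k a ↔ ∃ i, ∀ v ∈ G, v ∈ C A ρ k a ∧ ofLex v i ≠ 0 := by
  have key : G.inf' hG (fun v => (ofLex v : Fin r →₀ ℕ)) ≠ 0 ↔ ∃ i, ∀ v ∈ G, ofLex v i ≠ 0 := by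
    constructor
    · intro h
      obtain ⟨i, hi⟩ := Finsupp.ne_iff.1 h
      refine ⟨i, fun v hv h0 => hi ?_⟩
      have := Finset.inf'_le (fun v => (ofLex v : Fin r →₀ ℕ)) hv i
      rw [h0] at this
      exact Nat.le_zero.1 this
    · rintro ⟨i, hi⟩ h0
      have : Finsupp.single i 1 ≤ G.inf' hG (fun v => (ofLex v : Fin r →₀ ℕ)) := by
        refine Finset.le_inf' _ _ fun v hv => ?_
        rw [Finsupp.single_le_iff]
        exact Nat.one_le_iff_ne_zero.2 (hi v hv)
      rw [h0] at this
      have := this i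
      simp at this
  constructor
  · rintro ⟨h1, h2⟩
    obtain ⟨i, hi⟩ := key.1 (h2 hG)
    exact ⟨i, fun v hv => ⟨h1 hv, hi v hv⟩⟩
  · rintro ⟨i, hi⟩
    exact ⟨fun v hv => (hi v hv).1, fun _ => key.2 ⟨i, fun v hv => (hi v hv).2⟩⟩

theorem reducedHomology_Γ_equiv_T (hA : FiniteFactorizations A) {ρ : Fin r ⊕ Fin s → ℕ}
    (hρ : IsVariableOrder ρ) (k : Type*) [Field k] (a : semigroup A) (i : ℤ) :
    Nonempty (ReducedHomology k (Γ A ρ k a) i ≃ₗ[k] ReducedHomology k (T A a) i) := by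
  have hC : (C A ρ k a).Finite := by
    refine ((finite_factorizations hA a).image fun m =>
      toLex (Finsupp.comapDomain Sum.inl m Sum.inl_injective.injOn)).subset ?_
    rintro v ⟨u, -, hu⟩
    refine ⟨_, hu, ?_⟩
    apply ofLex.injective
    ext i
    simp
  refine dowker (R := fun i v => v ∈ C A ρ k a ∧ ofLex v i ≠ 0) (Set.toFinite _) ?_ ?_ ?_ ?_
    (fun G hG => mem_Γ hG) i
  · exact hC.finite_subsets.preimage Finset.coe_injective.injOn |>.subset fun G hG => hG.1
  · obtain ⟨m, rfl⟩ := degA_surjective a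
    exact mem_T.2 ⟨degA A m, by simp⟩
  · exact ⟨by simp, fun h => absurd h Finset.not_nonempty_empty⟩
  · intro F hF
    rw [mem_T]
    constructor
    · rintro ⟨b, hb⟩
      obtain ⟨m, rfl⟩ := degA_surjective b
      -- Adding the variables of `F` to a factorization of `a - ∑_{e ∈ F} e` factors `a`; making the
      -- `Z`-part standard keeps them in the `Y`-part.
      obtain ⟨v, u, hv, hu, hdeg⟩ := exists_le_standard (k := k) hA hρ.1
        (m + ∑ i ∈ F, Finsupp.single (Sum.inl i) 1)
      refine ⟨toLex v, fun i hi => ⟨⟨u, hu, ?_⟩, ?_⟩⟩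
      · rw [ofLex_toLex, hdeg, degA_add, degA_sum_single, hb]
      · have h1 := hv i
        have h2 : 1 ≤ (∑ j ∈ F, Finsupp.single (Sum.inl j : Fin r ⊕ Fin s) 1 :
            Fin r ⊕ Fin s →₀ ℕ) (Sum.inl i) := by
          rw [Finsupp.finsetSum_apply]
          refine le_trans ?_ (Finset.single_le_sum (fun _ _ => Nat.zero_le _) hi)
          simp
        rw [Finsupp.add_apply] at h1
        rw [ofLex_toLex]
        omega
    · rintro ⟨v, hv⟩
      obtain ⟨i₀, hi₀⟩ := hF
      obtain ⟨u, hu, hdeg⟩ := (hv i₀ hi₀).1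
      have hle : (∑ i ∈ F, Finsupp.single (Sum.inl i) 1 : Fin r ⊕ Fin s →₀ ℕ) ≤
          Finsupp.sumElim (ofLex v) u := by
        classical
        rintro (i | j)
        · rw [Finsupp.finsetSum_apply, Finsupp.sumElim_inl]
          by_cases hi : i ∈ F
          · rw [Finset.sum_eq_single_of_mem i hi]
            · rw [Finsupp.single_eq_same]
              exact Nat.one_le_iff_ne_zero.2 (hv i hi).2
            · intro j _ hj
              exact Finsupp.single_eq_of_ne fun h => hj (Sum.inl_injective h).symm
          · rw [Finset.sum_eq_zero]
            · exact Nat.zero_le _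
            · intro j hj
              exact Finsupp.single_eq_of_ne fun h => hi (Sum.inl_injective h ▸ hj)
        · rw [Finsupp.finsetSum_apply, Finset.sum_eq_zero]
          · exact Nat.zero_le _
          · intro j _
            simp
      obtain ⟨c, hc⟩ := exists_add_of_le hle
      refine ⟨degA A c, ?_⟩
      rw [← hdeg, hc, degA_add, degA_sum_single, add_comm]

end Factorizations

theorem submoduleOf_bot {k V : Type*} [Field k] [AddCommGroup V] [Module k V]
    (N : Submodule k V) : (⊥ : Submodule k V).submoduleOf N = ⊥ := by
  ext x
  simp [Submodule.submoduleOf]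

/-- The subquotient `V / 0` is `V`. -/
theorem subquotient_top_bot_equiv (k V : Type*) [Field k] [AddCommGroup V] [Module k V] :
    Nonempty (Subquotient (⊤ : Submodule k V) ⊥ ≃ₗ[k] V) := by
  let e : ((⊤ : Submodule k V) ⧸ (⊥ : Submodule k V).submoduleOf ⊤) ≃ₗ[k] V :=
    (Submodule.quotEquivOfEqBot _ (submoduleOf_bot ⊤)).trans Submodule.topEquiv
  exact ⟨e⟩

/-! ### Graded pieces of Koszul complexes -/

section KoszulPart

variable {k X N N' M : Type*} [Field k] [LinearOrder X] [AddCommGroup N] [Module k N]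
  [AddCommGroup N'] [Module k N'] [AddCommGroup M] [Module k M]

/-- The Koszul chains of homological degree `i` whose coefficient at `F` lies in `𝒩 F`. -/
def koszulPart (𝒩 : Finset X → Submodule k N) (i : ℤ) : Submodule k (Finset X →₀ N) where
  carrier := {z | ∀ F, z F ∈ 𝒩 F ∧ (z F ≠ 0 → (F.card : ℤ) = i)}
  zero_mem' := fun F => ⟨zero_mem _, fun h => absurd rfl h⟩
  add_mem' := by
    intro z w hz hw F
    refine ⟨add_mem (hz F).1 (hw F).1, fun h => ?_⟩
    by_cases h0 : z F = 0
    · exact (hw F).2 fun h1 => h (by rw [Finsupp.add_apply, h0, h1, add_zero])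
    · exact (hz F).2 h0
  smul_mem' := by
    intro c z hz F
    refine ⟨Submodule.smul_mem _ c (hz F).1, fun h => (hz F).2 fun h0 => h ?_⟩
    rw [Finsupp.smul_apply, h0, smul_zero]

theorem single_mem_koszulPart {𝒩 : Finset X → Submodule k N} {i : ℤ} {F : Finset X} {n : N}
    (hn : n ∈ 𝒩 F) (hi : (F.card : ℤ) = i) : Finsupp.single F n ∈ koszulPart 𝒩 i := by
  classical
  intro G
  rw [Finsupp.single_apply]
  split_ifs with h
  · subst h; exact ⟨hn, fun _ => hi⟩
  · exact ⟨zero_mem _, fun h => absurd rfl h⟩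

theorem koszul_mem_koszulPart {𝒩 : Finset X → Submodule k N} {y : X → N →ₗ[k] N}
    (hy : ∀ F, ∀ x ∈ F, ∀ n ∈ 𝒩 F, y x n ∈ 𝒩 (F.erase x)) {i j : ℤ} (hj : j = i + 1)
    {z : Finset X →₀ N} (hz : z ∈ koszulPart 𝒩 j) : koszul y z ∈ koszulPart 𝒩 i := by
  subst hj
  refine map_mem_of_forall_single _ fun F hF => ?_
  rw [koszul_single]
  refine sum_mem fun x hx => Submodule.smul_mem _ _
    (single_mem_koszulPart (hy F x hx _ (hz F).1) ?_)
  have h1 := (hz F).2 hF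
  have h2 := Finset.card_pos.2 ⟨x, hx⟩
  rw [Finset.card_erase_of_mem hx]
  omega

theorem cone_mem_koszulPart {𝒩 : Finset X → Submodule k N} {c : X} {q : N →ₗ[k] N}
    (hq : ∀ F, c ∉ F → ∀ n ∈ 𝒩 F, q n ∈ 𝒩 (insert c F)) {i : ℤ}
    {z : Finset X →₀ N} (hz : z ∈ koszulPart 𝒩 i) : cone c q z ∈ koszulPart 𝒩 (i + 1) := by
  refine map_mem_of_forall_single _ fun F hF => ?_
  by_cases hc : c ∈ F
  · rw [cone_single_of_mem _ hc]; exact zero_mem _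
  · rw [cone_single_of_notMem _ hc]
    refine Submodule.smul_mem _ _ (single_mem_koszulPart (hq F hc _ (hz F).1) ?_)
    rw [Finset.card_insert_of_notMem hc, ← (hz F).2 hF]
    push_cast
    rfl

/-- Presents the Koszul complex of a syzygy module as the kernel of a chain map, the form used by
`homology_connecting_equiv`. -/
theorem koszulPart_inf_ker {X : Type*} (𝒩 : Finset X → Submodule k N) (f : N →ₗ[k] M) (i : ℤ) :
    koszulPart (fun F => 𝒩 F ⊓ LinearMap.ker f) i =
      koszulPart 𝒩 i ⊓ LinearMap.ker (Finsupp.mapRange.linearMap (α := Finset X) f) := by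
  ext z
  constructor
  · intro hz
    refine ⟨fun F => ⟨(hz F).1.1, (hz F).2⟩, ?_⟩
    rw [SetLike.mem_coe, LinearMap.mem_ker]
    ext F
    exact (hz F).1.2
  · rintro ⟨hz, hz'⟩ F
    exact ⟨⟨(hz F).1, DFunLike.congr_fun (show Finsupp.mapRange.linearMap f z = 0 from hz') F⟩,
      (hz F).2⟩

theorem map_koszulPart {𝒩' : Finset X → Submodule k N'} {𝒩 : Finset X → Submodule k N}
    {f : N' →ₗ[k] N} (h : ∀ F, (𝒩' F).map f = 𝒩 F) (i : ℤ) :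
    (koszulPart 𝒩' i).map (Finsupp.mapRange.linearMap f) = koszulPart 𝒩 i := by
  apply le_antisymm
  · rintro _ ⟨z, hz, rfl⟩ F
    refine ⟨h F ▸ ⟨z F, (hz F).1, rfl⟩, fun hF => (hz F).2 fun h0 => hF ?_⟩
    rw [Finsupp.mapRange.linearMap_apply, Finsupp.mapRange_apply, h0, map_zero]
  · intro z hz
    refine map_mem_of_forall_single LinearMap.id fun F hF => ?_
    obtain ⟨n, hn, hn'⟩ : z F ∈ (𝒩' F).map f := by rw [h]; exact (hz F).1
    refine ⟨Finsupp.single F n, single_mem_koszulPart hn ((hz F).2 hF), ?_⟩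
    rw [Finsupp.mapRange.linearMap_apply, Finsupp.mapRange_single, hn']
    rfl

theorem koszul_cone_add_cone_koszul_apply (y : X → N →ₗ[k] N) (c : X) (q : N →ₗ[k] N)
    (hq : q ∘ₗ y c = LinearMap.id) (hqy : ∀ x ≠ c, q ∘ₗ y x = y x ∘ₗ q) (z : Finset X →₀ N)
    (F : Finset X) :
    (koszul y (cone c q z) + cone c q (koszul y z)) F =
      if c ∈ F then z F else y c (q (z F)) := by
  classical
  induction z using Finsupp.induction_linear with
  | zero => simp
  | add z w hz hw =>
    have : koszul y (cone c q (z + w)) + cone c q (koszul y (z + w)) =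
        (koszul y (cone c q z) + cone c q (koszul y z)) +
        (koszul y (cone c q w) + cone c q (koszul y w)) := by
      simp only [map_add]; abel
    rw [this, Finsupp.add_apply, hz, hw]
    split_ifs <;> simp
  | single G n =>
    rw [koszul_cone_add_cone_koszul y c q hq hqy]
    by_cases hG : G = F
    · subst hG
      split_ifs <;> simp
    · split_ifs <;> simp [hG]

/-- The coefficient at `∅` is a signed sum of values of the operators. -/
theorem koszul_apply_empty_mem {y : X → N →ₗ[k] N} {Q : Submodule k N} {z : Finset X →₀ N}
    (h : ∀ F x, y x (z F) ∈ Q) : koszul y z ∅ ∈ Q := by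
  classical
  refine map_mem_of_forall_single (Finsupp.lapply ∅ ∘ₗ koszul y) fun F _ => ?_
  simp only [LinearMap.comp_apply, koszul_single, map_sum, map_smul, Finsupp.lapply_apply,
    Finsupp.single_apply]
  refine sum_mem fun x _ => Q.smul_mem _ ?_
  split_ifs
  · exact h F x
  · exact zero_mem _

theorem map_koszul_apply_empty {y : X → N →ₗ[k] N} {ε : N →ₗ[k] M} (hε : ∀ x n, ε (y x n) = 0)
    (z : Finset X →₀ N) : ε (koszul y z ∅) = 0 :=
  koszul_apply_empty_mem (Q := LinearMap.ker ε) fun _ x => hε x _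

/-- A Koszul complex whose operators have commuting left inverses `q` is exact up to the elements
killed by all `q`, which are detected by `ε`. -/
theorem exists_koszul_eq [Fintype X] {𝒩 : Finset X → Submodule k N} {y q : X → N →ₗ[k] N}
    (hyy : ∀ x z, y x ∘ₗ y z = y z ∘ₗ y x)
    (hq : ∀ x, q x ∘ₗ y x = LinearMap.id) (hqy : ∀ c, ∀ x ≠ c, q c ∘ₗ y x = y x ∘ₗ q c)
    (hqq : ∀ x z, q x ∘ₗ q z = q z ∘ₗ q x)
    (hy𝒩 : ∀ F, ∀ x ∈ F, ∀ n ∈ 𝒩 F, y x n ∈ 𝒩 (F.erase x))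
    (hq𝒩 : ∀ c F, c ∉ F → ∀ n ∈ 𝒩 F, q c n ∈ 𝒩 (insert c F))
    {ε : N →ₗ[k] M} (hε : ∀ x n, ε (y x n) = 0) (hqε : ∀ n, (∀ x, q x n = 0) → ε n = 0 → n = 0)
    {i : ℤ} {z : Finset X →₀ N} (hz : z ∈ koszulPart 𝒩 i) (hKz : koszul y z = 0)
    (hεz : ε (z ∅) = 0) : ∃ w ∈ koszulPart 𝒩 (i + 1), koszul y w = z := by
  classical
  have hKK : ∀ w, koszul y (koszul y w) = 0 := LinearMap.congr_fun (koszul_comp_self y hyy)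
  -- The variables are treated one at a time. Coning with `c` clears the coefficients at every `F ∋
  -- c` and makes the others killed by `q c`; since `q x` commutes with `y c` and `q c`, what was
  -- achieved for earlier `x` persists.
  have key : ∀ s : Finset X, ∃ w ∈ koszulPart 𝒩 (i + 1), ∀ F, ∀ x ∈ s,
      (x ∈ F → (z - koszul y w) F = 0) ∧ q x ((z - koszul y w) F) = 0 := by
    intro s
    induction s using Finset.induction_on with
    | empty => exact ⟨0, zero_mem _, by simp⟩
    | insert c s hc ih =>
      obtain ⟨w, hw, hws⟩ := ih
      set z' := z - koszul y w with hz'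
      have hz'mem : z' ∈ koszulPart 𝒩 i := sub_mem hz (koszul_mem_koszulPart hy𝒩 rfl hw)
      have hKz' : koszul y z' = 0 := by rw [hz', map_sub, hKK, hKz, sub_zero]
      have hcone := koszul_cone_add_cone_koszul_apply y c (q c) (hq c) (hqy c) z'
      rw [hKz', map_zero, add_zero] at hcone
      refine ⟨w + cone c (q c) z', add_mem hw (cone_mem_koszulPart (hq𝒩 c) hz'mem), ?_⟩
      intro F x hx
      have hval : (z - koszul y (w + cone c (q c) z')) F =
          if c ∈ F then 0 else z' F - y c (q c (z' F)) := by
        rw [map_add, ← sub_sub, ← hz', Finsupp.sub_apply, hcone]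
        split_ifs <;> simp
      rw [hval]
      have hqc : ∀ n, q c (y c n) = n := LinearMap.congr_fun (hq c)
      rcases Finset.mem_insert.1 hx with rfl | hxs
      · constructor
        · intro hxF; rw [if_pos hxF]
        · split_ifs <;> simp [hqc]
      · have hxc : c ≠ x := fun h => hc (h ▸ hxs)
        obtain ⟨h1, h2⟩ := hws F x hxs
        constructor
        · intro hxF; rw [h1 hxF]; simp
        · have e1 : ∀ n, q x (y c n) = y c (q x n) := LinearMap.congr_fun (hqy x c hxc)
          have e2 : ∀ n, q x (q c n) = q c (q x n) := LinearMap.congr_fun (hqq x c)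
          split_ifs
          · simp
          · rw [map_sub, e1, e2, h2]; simp
  obtain ⟨w, hw, hw'⟩ := key Finset.univ
  refine ⟨w, hw, (sub_eq_zero.1 ?_).symm⟩
  ext F
  rcases F.eq_empty_or_nonempty with rfl | ⟨x, hx⟩
  · refine hqε _ (fun x => (hw' ∅ x (Finset.mem_univ x)).2) ?_
    rw [Finsupp.sub_apply, map_sub, hεz, map_koszul_apply_empty hε, sub_zero]
  · exact (hw' F x (Finset.mem_univ x)).1 hx

end KoszulPart

/-! ### Free modules over the polynomial ring -/

section Free

open MvPolynomial

variable {d r s : ℕ} {A : Fin r ⊕ Fin s → Fin d → ℤ} {k : Type*} [Field k] {β : ℕ}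

/-- Multiplication by the variable `x`. -/
noncomputable def mulX (k : Type*) [Field k] {r : ℕ} (β : ℕ) (x : Fin r) :
    (Fin β → MvPolynomial (Fin r) k) →ₗ[k] (Fin β → MvPolynomial (Fin r) k) :=
  LinearMap.compLeft (LinearMap.mulLeft k (X x)) (Fin β)

/-- Division by the variable `x`, omitting the terms that `x` does not divide. -/
noncomputable def divX (k : Type*) [Field k] {r : ℕ} (β : ℕ) (x : Fin r) :
    (Fin β → MvPolynomial (Fin r) k) →ₗ[k] (Fin β → MvPolynomial (Fin r) k) :=
  LinearMap.compLeft
    { toFun := fun p => p.divMonomial (Finsupp.single x 1)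
      map_add' := fun p q => add_divMonomial p q _
      map_smul' := fun c p => by ext; simp [coeff_divMonomial] } (Fin β)

/-- The constant coefficients. -/
noncomputable def constCoeff (k : Type*) [Field k] (r β : ℕ) :
    (Fin β → MvPolynomial (Fin r) k) →ₗ[k] (Fin β → k) :=
  LinearMap.compLeft (lcoeff k (0 : Fin r →₀ ℕ)) (Fin β)

theorem mulX_apply (x : Fin r) (f : Fin β → MvPolynomial (Fin r) k) (j : Fin β) :
    mulX k β x f j = X x * f j := rfl

theorem mulX_eq_smul (x : Fin r) (f : Fin β → MvPolynomial (Fin r) k) :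
    mulX k β x f = (X x : MvPolynomial (Fin r) k) • f := rfl

theorem coeff_divX (x : Fin r) (f : Fin β → MvPolynomial (Fin r) k) (j : Fin β)
    (v : Fin r →₀ ℕ) : (divX k β x f j).coeff v = (f j).coeff (Finsupp.single x 1 + v) :=
  coeff_divMonomial _ _ _

theorem constCoeff_apply (f : Fin β → MvPolynomial (Fin r) k) (j : Fin β) :
    constCoeff k r β f j = (f j).coeff 0 := rfl

theorem mulX_comp_mulX (x z : Fin r) : mulX k β x ∘ₗ mulX k β z = mulX k β z ∘ₗ mulX k β x := by
  refine LinearMap.ext fun f => funext fun j => ?_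
  exact mul_left_comm (X x) (X z) (f j)

theorem divX_comp_mulX_self (x : Fin r) : divX k β x ∘ₗ mulX k β x = LinearMap.id := by
  refine LinearMap.ext fun f => funext fun j => ?_
  exact X_mul_divMonomial x (f j)

theorem divX_comp_mulX (c x : Fin r) (h : x ≠ c) :
    divX k β c ∘ₗ mulX k β x = mulX k β x ∘ₗ divX k β c := by
  classical
  refine LinearMap.ext fun f => funext fun j => ?_
  ext v
  simp only [LinearMap.comp_apply, coeff_divX, mulX_apply, coeff_X_mul', Finsupp.mem_support_iff,
    Finsupp.add_apply, Finsupp.single_eq_of_ne h, zero_add]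
  split_ifs with hv
  · rw [add_tsub_assoc_of_le]
    rw [Finsupp.single_le_iff]
    exact Nat.one_le_iff_ne_zero.2 hv
  · rfl

theorem divX_comp_divX (x z : Fin r) : divX k β x ∘ₗ divX k β z = divX k β z ∘ₗ divX k β x := by
  refine LinearMap.ext fun f => funext fun j => ?_
  ext v
  simp only [LinearMap.comp_apply, coeff_divX]
  rw [add_left_comm]

theorem constCoeff_mulX (x : Fin r) (f : Fin β → MvPolynomial (Fin r) k) :
    constCoeff k r β (mulX k β x f) = 0 := by
  funext j
  simp [constCoeff_apply, mulX_apply, coeff_X_mul']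

theorem eq_zero_of_divX_of_constCoeff (f : Fin β → MvPolynomial (Fin r) k)
    (h : ∀ x, divX k β x f = 0) (h0 : constCoeff k r β f = 0) : f = 0 := by
  funext j
  ext v
  by_cases hv : v = 0
  · subst hv; exact congrFun h0 j
  · obtain ⟨x, hx⟩ := Finsupp.ne_iff.1 hv
    have : Finsupp.single x 1 ≤ v := Finsupp.single_le_iff.2 (Nat.one_le_iff_ne_zero.2 hx)
    obtain ⟨w, rfl⟩ := exists_add_of_le this
    rw [← coeff_divX, h x]
    simp

theorem degE_add (v w : Fin r →₀ ℕ) : degE A (v + w) = degE A v + degE A w := by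
  simp [degE, add_smul, Finset.sum_add_distrib]

theorem degE_single (x : Fin r) : degE A (Finsupp.single x 1) = gen A (Sum.inl x) := by
  rw [degE, Finset.sum_eq_single x]
  · simp
  · intro y _ hy
    simp [hy.symm]
  · simp

/-- The homogeneous elements of degree `a - ∑_{x ∈ F} a_x` of the graded free module with basis
degrees `deg`. -/
def freePart (k : Type*) [Field k] (deg : Fin β → semigroup A) (a : semigroup A)
    (F : Finset (Fin r)) : Submodule k (Fin β → MvPolynomial (Fin r) k) where
  carrier := {f | ∀ j v, (f j).coeff v ≠ 0 →
    degE A v + deg j + ∑ x ∈ F, gen A (Sum.inl x) = a}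
  zero_mem' := by simp
  add_mem' := by
    intro f g hf hg j v hv
    by_cases h : (f j).coeff v = 0
    · exact hg j v fun h' => hv (by rw [Pi.add_apply, coeff_add, h, h', add_zero])
    · exact hf j v h
  smul_mem' := by
    intro c f hf j v hv
    exact hf j v fun h => hv (by rw [Pi.smul_apply, coeff_smul, h, smul_zero])

/-- Multiplying by `Y_x` raises the degree by `a_x`, which removing `x` from `F` compensates; this
makes the Koszul differential preserve the strand of degree `a`. -/
theorem mulX_mem_freePart {deg : Fin β → semigroup A} {a : semigroup A} (F : Finset (Fin r))
    (x : Fin r) (hx : x ∈ F) (f) (hf : f ∈ freePart k deg a F) :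
    mulX k β x f ∈ freePart k deg a (F.erase x) := by
  classical
  intro j v hv
  rw [mulX_apply, coeff_X_mul'] at hv
  split_ifs at hv with h
  · have := hf j _ hv
    have hv' : v = (v - Finsupp.single x 1) + Finsupp.single x 1 := by
      rw [tsub_add_cancel_of_le]
      rw [Finsupp.single_le_iff]
      exact Nat.one_le_iff_ne_zero.2 (Finsupp.mem_support_iff.1 h)
    rw [hv', degE_add, degE_single, ← this, ← Finset.add_sum_erase F _ hx]
    abel
  · exact absurd rfl hv

theorem divX_mem_freePart {deg : Fin β → semigroup A} {a : semigroup A} (c : Fin r)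
    (F : Finset (Fin r)) (hc : c ∉ F) (f) (hf : f ∈ freePart k deg a F) :
    divX k β c f ∈ freePart k deg a (insert c F) := by
  intro j v hv
  rw [coeff_divX] at hv
  rw [← hf j _ hv, Finset.sum_insert hc, degE_add, degE_single]
  abel

/-- Each `mulX` has the left inverse `divX`, and only constants are killed by every `divX`, so
constants at `∅` are the sole obstruction to exactness. -/
theorem exists_koszul_mulX_eq {deg : Fin β → semigroup A} {a : semigroup A} {i : ℤ}
    {z : Finset (Fin r) →₀ (Fin β → MvPolynomial (Fin r) k)}
    (hz : z ∈ koszulPart (freePart k deg a) i) (hKz : koszul (mulX k β) z = 0)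
    (hz0 : constCoeff k r β (z ∅) = 0) :
    ∃ w ∈ koszulPart (freePart k deg a) (i + 1), koszul (mulX k β) w = z :=
  exists_koszul_eq mulX_comp_mulX divX_comp_mulX_self divX_comp_mulX divX_comp_divX
    mulX_mem_freePart divX_mem_freePart constCoeff_mulX eq_zero_of_divX_of_constCoeff hz hKz hz0

variable {N : Type*} [AddCommGroup N] [Module k N] {y : Fin r → N →ₗ[k] N}
  {𝒩 : Finset (Fin r) → Submodule k N} {deg : Fin β → semigroup A} {a : semigroup A}
  {π : (Fin β → MvPolynomial (Fin r) k) →ₗ[k] N}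

/-- Passing to the kernel of a minimal free cover shifts Koszul homology. -/
theorem koszulHomology_succ_equiv (hπ : ∀ x, π ∘ₗ mulX k β x = y x ∘ₗ π)
    (hπ𝒩 : ∀ F, (freePart k deg a F).map π = 𝒩 F)
    (hmin : ∀ f, π f = 0 → constCoeff k r β f = 0) {i : ℤ} (hi : 0 ≤ i) :
    Nonempty (Homology (koszul y) (koszulPart 𝒩) (i + 1) ≃ₗ[k] Homology (koszul (mulX k β))
      (koszulPart fun F => freePart k deg a F ⊓ LinearMap.ker π) i) := by
  have : koszulPart (fun F => freePart k deg a F ⊓ LinearMap.ker π) =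
      fun i => koszulPart (freePart k deg a) i ⊓
        LinearMap.ker (Finsupp.mapRange.linearMap (α := Finset (Fin r)) π) :=
    funext fun i => koszulPart_inf_ker _ _ _
  rw [this]
  refine homology_connecting_equiv (koszul_comp_self _ mulX_comp_mulX)
    (Finsupp.mapRange.linearMap π) (mapRange_comp_koszul _ _ _ hπ)
    (fun i z hz => koszul_mem_koszulPart mulX_mem_freePart rfl hz)
    (fun i => map_koszulPart hπ𝒩 i) ?_ ?_
  · intro z hz hKz
    refine exists_koszul_mulX_eq hz hKz ?_
    have : z ∅ = 0 := by
      by_contra h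
      have := (hz ∅).2 h
      simp at this
      omega
    rw [this, map_zero]
  -- Minimality enters here: a cycle with values in `ker π` has no constant term at `∅`.
  · intro z hz hKz hπz
    refine exists_koszul_mulX_eq hz hKz (hmin _ ?_)
    exact DFunLike.congr_fun hπz ∅

/-- The degree `0` Koszul homology counts the generators of a minimal free cover. -/
theorem koszulHomology_zero_equiv (hπ : ∀ x, π ∘ₗ mulX k β x = y x ∘ₗ π)
    (hπ𝒩 : ∀ F, (freePart k deg a F).map π = 𝒩 F)
    (hmin : ∀ f, π f = 0 → constCoeff k r β f = 0) :
    Nonempty (Homology (koszul y) (koszulPart 𝒩) 0 ≃ₗ[k]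
      Subquotient (⊤ : Submodule k ({j // deg j = a} → k)) ⊥) := by
  classical
  have hπK : ∀ z, Finsupp.mapRange.linearMap π (koszul (mulX k β) z) =
      koszul y (Finsupp.mapRange.linearMap π z) :=
    LinearMap.congr_fun (mapRange_comp_koszul _ _ _ hπ)
  have hK : ∀ z ∈ koszulPart 𝒩 0, koszul y z = 0 := by
    intro z hz
    refine (Submodule.mem_bot k).1 (map_mem_of_forall_single (koszul y) fun F hF => ?_)
    have := (hz F).2 hF
    rw [Nat.cast_eq_zero, Finset.card_eq_zero] at this
    subst this
    simp [koszul_single]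
  have hK' : ∀ z ∈ koszulPart (freePart k deg a) 0, koszul (mulX k β) z = 0 := by
    intro z hz
    refine (Submodule.mem_bot k).1 (map_mem_of_forall_single (koszul (mulX k β)) fun F hF => ?_)
    have := (hz F).2 hF
    rw [Nat.cast_eq_zero, Finset.card_eq_zero] at this
    subst this
    simp [koszul_single]
  -- The degree `0` chains of the cover map to both sides, by `π` and by reading constant
  -- coefficients at the basis elements of degree `a`; the two kernels agree modulo boundaries.
  refine subquotient_equiv (P := koszulPart (freePart k deg a) 0)
    (Finsupp.mapRange.linearMap π ∘ₗ Submodule.subtype _)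
    (LinearMap.funLeft k k Subtype.val ∘ₗ constCoeff k r β ∘ₗ Finsupp.lapply ∅ ∘ₗ
      Submodule.subtype _) ?_ (fun _ => trivial) ?_ ?_ ?_
  · rintro ⟨z, hz⟩
    have : Finsupp.mapRange.linearMap π z ∈ koszulPart 𝒩 0 :=
      map_koszulPart hπ𝒩 0 ▸ ⟨z, hz, rfl⟩
    exact ⟨this, hK _ this⟩
  · rintro n ⟨hn, -⟩
    rw [← map_koszulPart hπ𝒩 0] at hn
    obtain ⟨z, hz, rfl⟩ := hn
    exact ⟨⟨z, hz⟩, by simp⟩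
  · intro c _
    refine ⟨⟨Finsupp.single ∅ fun j => if h : deg j = a then MvPolynomial.C (c ⟨j, h⟩) else 0,
      single_mem_koszulPart ?_ rfl⟩, ?_⟩
    · intro j v hv
      dsimp only at hv
      split_ifs at hv with h
      · rw [coeff_C] at hv
        split_ifs at hv with h'
        · subst h'; simp [degE, h]
        · exact absurd rfl hv
      · exact absurd (coeff_zero v) hv
    · rw [Submodule.mem_bot, sub_eq_zero]
      funext j
      simp [constCoeff_apply, LinearMap.funLeft_apply, j.2]
  · rintro ⟨z, hz⟩
    constructor
    · rintro ⟨w, hw, hwz⟩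
      rw [← map_koszulPart hπ𝒩] at hw
      obtain ⟨w, hw, rfl⟩ := hw
      rw [← hπK] at hwz
      have h0 : π ((z - koszul (mulX k β) w) ∅) = 0 := by
        have : Finsupp.mapRange.linearMap π (z - koszul (mulX k β) w) = 0 := by
          rw [map_sub, hwz]; simp
        exact DFunLike.congr_fun this ∅
      have h1 := hmin _ h0
      rw [Finsupp.sub_apply, map_sub, map_koszul_apply_empty constCoeff_mulX, sub_zero] at h1
      rw [Submodule.mem_bot]
      funext j
      exact congrFun h1 j.1
    · intro h
      rw [Submodule.mem_bot] at h
      obtain ⟨w, hw, hwz⟩ := exists_koszul_mulX_eq hz (hK' z hz) (by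
        funext j
        -- A constant coefficient at a basis element of another degree vanishes by homogeneity.
        by_cases hj : deg j = a
        · exact congrFun h ⟨j, hj⟩
        · by_contra h0
          exact hj (by simpa [degE] using (hz ∅).1 j 0 h0))
      refine ⟨Finsupp.mapRange.linearMap π w, map_koszulPart hπ𝒩 (0 + 1) ▸ ⟨w, hw, rfl⟩, ?_⟩
      rw [← hπK, hwz]; rfl

theorem rank_koszulHomology_zero (hπ : ∀ x, π ∘ₗ mulX k β x = y x ∘ₗ π)
    (hπ𝒩 : ∀ F, (freePart k deg a F).map π = 𝒩 F)
    (hmin : ∀ f, π f = 0 → constCoeff k r β f = 0) :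
    Module.rank k (Homology (koszul y) (koszulPart 𝒩) 0) =
      (Nat.card {j // deg j = a} : Cardinal) := by
  classical
  obtain ⟨e⟩ := koszulHomology_zero_equiv hπ hπ𝒩 hmin
  obtain ⟨e'⟩ := subquotient_top_bot_equiv k ({j // deg j = a} → k)
  have h := (e.trans e').lift_rank_eq
  rw [rank_fun', Cardinal.lift_natCast, Cardinal.lift_eq_nat_iff] at h
  rw [h, Nat.card_eq_fintype_card]

end Free

/-! ### Homogeneous components -/

section Components

open MvPolynomial

variable {d r s : ℕ} {A : Fin r ⊕ Fin s → Fin d → ℤ} {k : Type*} [Field k] {β : ℕ}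

/-- The projection of `k[Y]` onto the span of the monomials satisfying `p`. -/
noncomputable def monomialProj (k : Type*) [Field k] {σ : Type*} (p : (σ →₀ ℕ) → Prop)
    [DecidablePred p] : MvPolynomial σ k →ₗ[k] MvPolynomial σ k :=
  (basisMonomials σ k).constr k fun v => if p v then monomial v 1 else 0

theorem monomialProj_monomial {σ : Type*} (p : (σ →₀ ℕ) → Prop) [DecidablePred p] (v : σ →₀ ℕ)
    (c : k) : monomialProj k p (monomial v c) = if p v then monomial v c else 0 := by
  have h1 : monomialProj k p (monomial v 1) = if p v then monomial v 1 else 0 := by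
    have := (basisMonomials σ k).constr_basis k
      (fun v => if p v then (monomial v 1 : MvPolynomial σ k) else 0) v
    rwa [coe_basisMonomials] at this
  have h2 : (monomial v c : MvPolynomial σ k) = c • monomial v 1 := by simp [smul_monomial]
  rw [h2, map_smul, h1]
  split_ifs <;> simp

theorem coeff_monomialProj {σ : Type*} (p : (σ →₀ ℕ) → Prop) [DecidablePred p]
    (f : MvPolynomial σ k) (v : σ →₀ ℕ) :
    (monomialProj k p f).coeff v = if p v then f.coeff v else 0 := by
  classical
  induction f using MvPolynomial.induction_on' with
  | monomial w c =>
    rw [monomialProj_monomial]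
    by_cases hv : w = v
    · subst hv; split_ifs <;> simp
    · split_ifs <;> simp [coeff_monomial, hv]
  | add f g hf hg =>
    rw [map_add, coeff_add, hf, hg, coeff_add]
    split_ifs <;> simp

open Classical in
/-- The projection of a graded free module onto its homogeneous elements of degree
`a - ∑_{x ∈ F} a_x`. -/
noncomputable def freeProj (k : Type*) [Field k] (deg : Fin β → semigroup A) (a : semigroup A)
    (F : Finset (Fin r)) :
    (Fin β → MvPolynomial (Fin r) k) →ₗ[k] (Fin β → MvPolynomial (Fin r) k) :=
  LinearMap.pi fun j => monomialProj k
    (fun v => degE A v + deg j + ∑ x ∈ F, gen A (Sum.inl x) = a) ∘ₗ LinearMap.proj j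

variable {deg : Fin β → semigroup A} {a : semigroup A} {F : Finset (Fin r)}

open Classical in
theorem coeff_freeProj (f : Fin β → MvPolynomial (Fin r) k) (j : Fin β) (v : Fin r →₀ ℕ) :
    (freeProj k deg a F f j).coeff v =
      if degE A v + deg j + ∑ x ∈ F, gen A (Sum.inl x) = a then (f j).coeff v else 0 :=
  coeff_monomialProj _ _ _

theorem freeProj_mem (f : Fin β → MvPolynomial (Fin r) k) :
    freeProj k deg a F f ∈ freePart k deg a F := by
  classical
  intro j v hv
  rw [coeff_freeProj] at hv
  by_contra h
  exact hv (if_neg h)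

theorem freeProj_eq_self {f : Fin β → MvPolynomial (Fin r) k} (hf : f ∈ freePart k deg a F) :
    freeProj k deg a F f = f := by
  classical
  funext j
  ext v
  rw [coeff_freeProj]
  split_ifs with h
  · rfl
  · by_contra h0
    exact h (hf j v (Ne.symm h0))

open Classical in
/-- The projection of a homogeneous element. -/
theorem freeProj_of_homogeneous {f : Fin β → MvPolynomial (Fin r) k} {b : semigroup A}
    (hf : ∀ j v, (f j).coeff v ≠ 0 → degE A v + deg j = b) :
    freeProj k deg a F f = if b + ∑ x ∈ F, gen A (Sum.inl x) = a then f else 0 := by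
  funext j
  ext v
  rw [coeff_freeProj]
  by_cases h0 : (f j).coeff v = 0
  · split_ifs <;> simp [h0]
  · rw [hf j v h0]
    split_ifs <;> simp

theorem linearMap_ext_monomial {M : Type*} [AddCommGroup M] [Module k M]
    {f g : (Fin β → MvPolynomial (Fin r) k) →ₗ[k] M}
    (h : ∀ (j : Fin β) (v : Fin r →₀ ℕ), f (monomial v (1 : k) • Pi.single j 1) =
      g (monomial v (1 : k) • Pi.single j 1)) :
    f = g := by
  refine LinearMap.pi_ext' fun j => (basisMonomials (Fin r) k).ext fun v => ?_
  have : (monomial v (1 : k) : MvPolynomial (Fin r) k) •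
      (Pi.single j 1 : Fin β → MvPolynomial (Fin r) k) = Pi.single j (monomial v 1) := by
    rw [← Pi.single_smul, smul_eq_mul, mul_one]
  have h' := h j v
  rw [this] at h'
  simpa using h'

theorem coeff_monomial_smul_ne_zero {v w : Fin r →₀ ℕ} {f : Fin β → MvPolynomial (Fin r) k}
    {j : Fin β} (h : ((monomial v (1 : k) • f) j).coeff w ≠ 0) :
    ∃ u, w = v + u ∧ (f j).coeff u ≠ 0 := by
  rw [Pi.smul_apply, smul_eq_mul, coeff_monomial_mul'] at h
  split_ifs at h with hle
  · obtain ⟨u, rfl⟩ := exists_add_of_le hle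
    exact ⟨u, rfl, by simpa using h⟩
  · exact absurd rfl h

open Classical in
theorem freeProj_monomial_smul_single (j : Fin β) (v : Fin r →₀ ℕ) :
    freeProj k deg a F (monomial v (1 : k) • Pi.single j 1) =
      if degE A v + deg j + ∑ x ∈ F, gen A (Sum.inl x) = a
        then monomial v (1 : k) • Pi.single j 1 else 0 := by
  refine freeProj_of_homogeneous fun l w hw => ?_
  obtain ⟨u, rfl, hu⟩ := coeff_monomial_smul_ne_zero hw
  by_cases hl : l = j
  · subst hl
    rw [Pi.single_eq_same, coeff_one] at hu
    split_ifs at hu with h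
    · rw [← h, add_zero]
    · exact absurd rfl hu
  · rw [Pi.single_eq_of_ne hl] at hu
    exact absurd (coeff_zero u) hu

/-- Homogeneous components of `k[S]`. -/
def algPart (k : Type*) [Field k] (a : semigroup A) (F : Finset (Fin r)) :
    Submodule k (AddMonoidAlgebra k (semigroup A)) where
  carrier := {n | ∀ c, n.coeff c ≠ 0 → c + ∑ x ∈ F, gen A (Sum.inl x) = a}
  zero_mem' := by simp
  add_mem' := by
    intro f g hf hg c hc
    by_cases h : f.coeff c = 0
    · exact hg c fun h' => hc (by rw [AddMonoidAlgebra.coeff_add, Finsupp.add_apply, h, h',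
        add_zero])
    · exact hf c h
  smul_mem' := by
    intro t f hf c hc
    exact hf c fun h => hc (by rw [AddMonoidAlgebra.coeff_smul, Finsupp.smul_apply, h, smul_zero])

open Classical in
/-- The projection of `k[S]` onto a homogeneous component. -/
noncomputable def algProj (k : Type*) [Field k] (a : semigroup A) (F : Finset (Fin r)) :
    AddMonoidAlgebra k (semigroup A) →ₗ[k] AddMonoidAlgebra k (semigroup A) :=
  (AddMonoidAlgebra.coeffLinearEquiv k).symm.toLinearMap ∘ₗ
    (Finsupp.supported k k {c | c + ∑ x ∈ F, gen A (Sum.inl x) = a}).subtype ∘ₗ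
    Finsupp.restrictDom k k {c | c + ∑ x ∈ F, gen A (Sum.inl x) = a} ∘ₗ
    (AddMonoidAlgebra.coeffLinearEquiv k).toLinearMap

open Classical in
theorem coeff_algProj (n : AddMonoidAlgebra k (semigroup A)) (c : semigroup A) :
    (algProj k a F n).coeff c =
      if c + ∑ x ∈ F, gen A (Sum.inl x) = a then n.coeff c else 0 := by
  change (n.coeff.filter (· ∈ {c | c + ∑ x ∈ F, gen A (Sum.inl x) = a})) c = _
  rw [Finsupp.filter_apply]
  rfl

theorem algProj_eq_self {n : AddMonoidAlgebra k (semigroup A)} (hn : n ∈ algPart k a F) :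
    algProj k a F n = n := by
  classical
  ext c
  rw [coeff_algProj]
  split_ifs with h
  · rfl
  · by_contra h0
    exact h (hn c (Ne.symm h0))

open Classical in
theorem algProj_single (b : semigroup A) (t : k) :
    algProj k a F (AddMonoidAlgebra.single b t) =
      if b + ∑ x ∈ F, gen A (Sum.inl x) = a then AddMonoidAlgebra.single b t else 0 := by
  ext c
  rw [coeff_algProj]
  by_cases h : b = c
  · subst h; split_ifs <;> simp
  · split_ifs <;> simp [h]

theorem algProj_mem (n : AddMonoidAlgebra k (semigroup A)) : algProj k a F n ∈ algPart k a F := by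
  classical
  intro c hc
  rw [coeff_algProj] at hc
  by_contra h
  exact hc (if_neg h)

/-- Multiplication of `k[S]` by the image of the variable `x`. -/
noncomputable def algMulX (A : Fin r ⊕ Fin s → Fin d → ℤ) (k : Type*) [Field k] (x : Fin r) :
    AddMonoidAlgebra k (semigroup A) →ₗ[k] AddMonoidAlgebra k (semigroup A) :=
  LinearMap.mulLeft k (AddMonoidAlgebra.single (gen A (Sum.inl x)) 1)

theorem phiE_monomial (v : Fin r →₀ ℕ) (c : k) :
    phiE A k (monomial v c) = AddMonoidAlgebra.single (degE A v) c := by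
  have h := phiA_monomial (A := A) (k := k) (Finsupp.sumElim v 0) c
  have h1 : degA A (Finsupp.sumElim v 0) = degE A v := by
    simp [degA, degE]
  rw [h1] at h
  rw [← h, phiA, phiE, aeval_monomial, aeval_monomial, Finsupp.prod_fintype _ _ (by simp),
    Finsupp.prod_fintype _ _ (by simp)]
  simp

end Components

/-! ### Betti numbers of a minimal resolution -/

namespace GradedFreeResolution

open MvPolynomial

variable {d r s : ℕ} {A : Fin r ⊕ Fin s → Fin d → ℤ} {k : Type*} [Field k]
  (P : GradedFreeResolution A k)

/-- The augmentation as a `k`-linear map. -/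
noncomputable def augLin :
    (Fin (P.β 0) → MvPolynomial (Fin r) k) →ₗ[k] AddMonoidAlgebra k (semigroup A) where
  toFun := P.aug
  map_add' := map_add P.aug
  map_smul' := by
    intro c f
    have h1 : c • f = (MvPolynomial.C c : MvPolynomial (Fin r) k) • f := by
      funext j
      simp [smul_eq_C_mul]
    have h2 : phiE A k (MvPolynomial.C c) = algebraMap k _ c := (phiE A k).commutes c
    rw [h1, P.aug.map_smulₛₗ]
    change phiE A k (MvPolynomial.C c) * P.aug f = c • P.aug f
    rw [h2, Algebra.smul_def]

/-- The differential as a `k`-linear map. -/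
noncomputable def mapLin (p : ℕ) :
    (Fin (P.β (p + 1)) → MvPolynomial (Fin r) k) →ₗ[k] (Fin (P.β p) → MvPolynomial (Fin r) k) :=
  (P.map p).restrictScalars k

theorem aug_smul (g : MvPolynomial (Fin r) k) (f : Fin (P.β 0) → MvPolynomial (Fin r) k) :
    P.augLin (g • f) = phiE A k g * P.augLin f :=
  P.aug.map_smulₛₗ g f

theorem augLin_comp_mulX (x : Fin r) :
    P.augLin ∘ₗ mulX k (P.β 0) x = algMulX A k x ∘ₗ P.augLin := by
  refine LinearMap.ext fun f => ?_
  rw [LinearMap.comp_apply, mulX_eq_smul, aug_smul, phiE, aeval_X]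
  rfl

theorem mapLin_comp_mulX (p : ℕ) (x : Fin r) :
    P.mapLin p ∘ₗ mulX k (P.β (p + 1)) x = mulX k (P.β p) x ∘ₗ P.mapLin p := by
  refine LinearMap.ext fun f => ?_
  rw [LinearMap.comp_apply, LinearMap.comp_apply, mulX_eq_smul, mulX_eq_smul]
  exact (P.map p).map_smul _ f

variable {a : semigroup A} {F : Finset (Fin r)}

/-- Graded maps commute with the projections onto homogeneous components, so surjectivity, and
likewise exactness of the resolution, descends to each degree by projecting an arbitrary preimage.
-/
theorem augLin_comp_freeProj :
    P.augLin ∘ₗ freeProj k (P.deg 0) a F = algProj k a F ∘ₗ P.augLin := by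
  classical
  refine linearMap_ext_monomial fun j v => ?_
  obtain ⟨c, hc⟩ := P.aug_homogeneous j
  have h : P.augLin (monomial v (1 : k) • Pi.single j 1) =
      AddMonoidAlgebra.single (degE A v + P.deg 0 j) c := by
    rw [aug_smul, phiE_monomial]
    change _ * P.aug (Pi.single j 1) = _
    rw [hc, AddMonoidAlgebra.single_mul_single, one_mul]
  rw [LinearMap.comp_apply, LinearMap.comp_apply, freeProj_monomial_smul_single, h,
    algProj_single]
  split_ifs
  · exact h
  · exact map_zero _

theorem mapLin_comp_freeProj (p : ℕ) :
    P.mapLin p ∘ₗ freeProj k (P.deg (p + 1)) a F =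
      freeProj k (P.deg p) a F ∘ₗ P.mapLin p := by
  classical
  refine linearMap_ext_monomial fun j v => ?_
  have h : P.mapLin p (monomial v (1 : k) • Pi.single j 1) =
      monomial v (1 : k) • P.map p (Pi.single j 1) := (P.map p).map_smul _ _
  rw [LinearMap.comp_apply, LinearMap.comp_apply, freeProj_monomial_smul_single, h,
    freeProj_of_homogeneous (b := degE A v + P.deg (p + 1) j)]
  · split_ifs
    · exact h
    · exact map_zero _
  · intro l w hw
    obtain ⟨u, rfl, hu⟩ := coeff_monomial_smul_ne_zero hw
    rw [degE_add, add_assoc, P.map_homogeneous p j l u (mem_support_iff.2 hu)]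

theorem mulX_comp_freeProj_erase {β : ℕ} {deg : Fin β → semigroup A} {x : Fin r} (hx : x ∈ F) :
    mulX k β x ∘ₗ freeProj k deg a F = freeProj k deg a (F.erase x) ∘ₗ mulX k β x := by
  classical
  refine linearMap_ext_monomial fun j v => ?_
  have h : mulX k β x (monomial v (1 : k) • Pi.single j 1) =
      monomial (v + Finsupp.single x 1) (1 : k) • Pi.single j 1 := by
    rw [mulX_eq_smul, smul_smul, X, monomial_mul, one_mul, add_comm]
  rw [LinearMap.comp_apply, LinearMap.comp_apply, freeProj_monomial_smul_single, h,
    freeProj_monomial_smul_single, degE_add, degE_single, ← Finset.add_sum_erase F _ hx]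
  have : degE A v + deg j + (gen A (Sum.inl x) + ∑ x ∈ F.erase x, gen A (Sum.inl x)) =
      degE A v + gen A (Sum.inl x) + deg j + ∑ x ∈ F.erase x, gen A (Sum.inl x) := by abel
  rw [this]
  split_ifs
  · exact h
  · exact map_zero _

/-- `M_p` as a `k`-subspace. -/
noncomputable def syz (p : ℕ) : Submodule k (Fin (P.β p) → MvPolynomial (Fin r) k) :=
  (P.M p).restrictScalars k

theorem syz_zero : P.syz 0 = LinearMap.ker P.augLin := rfl

theorem syz_succ (p : ℕ) : P.syz (p + 1) = LinearMap.ker (P.mapLin p) := rfl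

theorem range_mapLin (p : ℕ) : LinearMap.range (P.mapLin p) = P.syz p := by
  cases p with
  | zero =>
    ext f
    exact SetLike.ext_iff.1 P.exact_zero f
  | succ p =>
    ext f
    exact SetLike.ext_iff.1 (P.exact_succ p) f

theorem freeProj_mem_syz {p : ℕ} {f : Fin (P.β p) → MvPolynomial (Fin r) k} (hf : f ∈ P.syz p) :
    freeProj k (P.deg p) a F f ∈ P.syz p := by
  cases p with
  | zero =>
    rw [syz_zero, LinearMap.mem_ker] at hf ⊢
    rw [← LinearMap.comp_apply, augLin_comp_freeProj, LinearMap.comp_apply, hf, map_zero]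
  | succ p =>
    rw [syz_succ, LinearMap.mem_ker] at hf ⊢
    rw [← LinearMap.comp_apply, mapLin_comp_freeProj, LinearMap.comp_apply, hf, map_zero]

theorem map_augLin_freePart :
    (freePart k (P.deg 0) a F).map P.augLin = algPart k a F := by
  apply le_antisymm
  · rintro _ ⟨f, hf, rfl⟩
    rw [← freeProj_eq_self hf, ← LinearMap.comp_apply, augLin_comp_freeProj]
    exact algProj_mem _
  · intro n hn
    obtain ⟨f, rfl⟩ := P.aug_surjective n
    refine ⟨freeProj k (P.deg 0) a F f, freeProj_mem f, ?_⟩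
    rw [← LinearMap.comp_apply, augLin_comp_freeProj]
    exact algProj_eq_self hn

theorem map_mapLin_freePart (p : ℕ) :
    (freePart k (P.deg (p + 1)) a F).map (P.mapLin p) = freePart k (P.deg p) a F ⊓ P.syz p := by
  rw [← range_mapLin]
  apply le_antisymm
  · rintro _ ⟨f, hf, rfl⟩
    refine ⟨?_, f, rfl⟩
    rw [← freeProj_eq_self hf, ← LinearMap.comp_apply, mapLin_comp_freeProj]
    exact freeProj_mem _
  · rintro _ ⟨hn, f, rfl⟩
    refine ⟨freeProj k (P.deg (p + 1)) a F f, freeProj_mem f, ?_⟩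
    rw [← LinearMap.comp_apply, mapLin_comp_freeProj]
    exact freeProj_eq_self hn

/-- By exactness a syzygy is in the image of the next differential, whose matrix entries have no
constant term. -/
theorem constCoeff_eq_zero_of_mem_syz (hP : P.IsMinimal) {p : ℕ}
    {f : Fin (P.β p) → MvPolynomial (Fin r) k} (hf : f ∈ P.syz p) :
    constCoeff k r (P.β p) f = 0 := by
  rw [← range_mapLin] at hf
  obtain ⟨g, rfl⟩ := hf
  funext l
  have h1 : P.mapLin p g = ∑ j, g j • P.map p (Pi.single j 1) := by
    change P.map p g = _
    conv_lhs => rw [pi_eq_sum_univ' g]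
    rw [map_sum]
    refine Finset.sum_congr rfl fun j _ => ?_
    rw [map_smul]
  rw [h1, constCoeff_apply, ← constantCoeff_eq, Finset.sum_apply, map_sum]
  refine Finset.sum_eq_zero fun j _ => ?_
  rw [Pi.smul_apply, smul_eq_mul, map_mul, hP, mul_zero]

/-! ### Dimension shifting along the resolution -/

variable (a)

/-- The Koszul homology of `M_p` in degree `a`. -/
abbrev SyzHomology (p : ℕ) (i : ℤ) : Type _ :=
  Homology (koszul (mulX k (P.β p))) (koszulPart fun F => freePart k (P.deg p) a F ⊓ P.syz p) i

/-- The Koszul homology of `k[S]` in degree `a`. -/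
abbrev AlgHomology (A : Fin r ⊕ Fin s → Fin d → ℤ) (k : Type*) [Field k] (a : semigroup A)
    (i : ℤ) : Type _ :=
  Homology (koszul (algMulX A k)) (koszulPart (algPart k a)) i

variable {P}

theorem algHomology_succ_equiv (hP : P.IsMinimal) {i : ℤ} (hi : 0 ≤ i) :
    Nonempty (AlgHomology A k a (i + 1) ≃ₗ[k] P.SyzHomology a 0 i) :=
  koszulHomology_succ_equiv P.augLin_comp_mulX (fun _ => P.map_augLin_freePart)
    (fun _ hf => P.constCoeff_eq_zero_of_mem_syz hP (p := 0) hf) hi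

theorem syzHomology_succ_equiv (hP : P.IsMinimal) (p : ℕ) {i : ℤ} (hi : 0 ≤ i) :
    Nonempty (P.SyzHomology a p (i + 1) ≃ₗ[k] P.SyzHomology a (p + 1) i) :=
  koszulHomology_succ_equiv (P.mapLin_comp_mulX p) (fun _ => P.map_mapLin_freePart p)
    (fun _ hf => P.constCoeff_eq_zero_of_mem_syz hP (p := p + 1) hf) hi

theorem syzHomology_add_equiv (hP : P.IsMinimal) (n p : ℕ) :
    Nonempty (P.SyzHomology a p n ≃ₗ[k] P.SyzHomology a (p + n) 0) := by
  induction n generalizing p with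
  | zero => exact ⟨LinearEquiv.refl _ _⟩
  | succ n ih =>
    -- Each shift lowers the homological degree and raises the syzygy index, so the induction must
    -- hold for all `p`.
    obtain ⟨e⟩ := syzHomology_succ_equiv a hP p (Int.natCast_nonneg n)
    obtain ⟨e'⟩ := ih (p + 1)
    have h : p + 1 + n = p + (n + 1) := by omega
    rw [h] at e'
    rw [Nat.cast_succ]
    exact ⟨e.trans e'⟩

theorem algHomology_equiv_syzHomology (hP : P.IsMinimal) (n : ℕ) :
    Nonempty (AlgHomology A k a (n + 1) ≃ₗ[k] P.SyzHomology a n 0) := by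
  obtain ⟨e⟩ := algHomology_succ_equiv a hP (Int.natCast_nonneg n)
  obtain ⟨e'⟩ := syzHomology_add_equiv a hP n 0
  rw [zero_add] at e'
  exact ⟨e.trans e'⟩

theorem rank_algHomology_zero (hP : P.IsMinimal) :
    Module.rank k (AlgHomology A k a 0) = (P.betti 0 a : Cardinal) :=
  rank_koszulHomology_zero P.augLin_comp_mulX (fun _ => P.map_augLin_freePart)
    (fun _ hf => P.constCoeff_eq_zero_of_mem_syz hP (p := 0) hf)

theorem rank_syzHomology_zero (hP : P.IsMinimal) (p : ℕ) :
    Module.rank k (P.SyzHomology a p 0) = (P.betti (p + 1) a : Cardinal) :=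
  rank_koszulHomology_zero (P.mapLin_comp_mulX p) (fun _ => P.map_mapLin_freePart p)
    (fun _ hf => P.constCoeff_eq_zero_of_mem_syz hP (p := p + 1) hf)

theorem rank_algHomology (hP : P.IsMinimal) (p : ℕ) :
    Module.rank k (AlgHomology A k a p) = (P.betti p a : Cardinal) := by
  cases p with
  | zero => exact rank_algHomology_zero a hP
  | succ p =>
    obtain ⟨e⟩ := algHomology_equiv_syzHomology a hP p
    rw [← rank_syzHomology_zero a hP p, ← e.rank_eq, Nat.cast_succ]

/-! ### Koszul homology in degree zero and `W_p(a)` -/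

variable (P)

theorem mem_MComponent {p : ℕ} {f : Fin (P.β p) → MvPolynomial (Fin r) k} :
    f ∈ P.MComponent p a ↔ f ∈ freePart k (P.deg p) a ∅ ⊓ P.syz p := by
  refine and_congr ?_ Iff.rfl
  change (∀ j, ∀ v ∈ (f j).support, _) ↔ ∀ j v, (f j).coeff v ≠ 0 → _
  simp only [mem_support_iff, Finset.sum_empty, add_zero]

theorem exists_eq_sum_X_smul {R M σ : Type*} [CommRing R] [AddCommGroup M] [Module R M]
    [Fintype σ] {X : σ → R} {N : Submodule R M} {n : M}
    (hn : n ∈ Ideal.span (Set.range X) • N) : ∃ g : σ → M, (∀ x, g x ∈ N) ∧ n = ∑ x, X x • g x := by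
  classical
  refine Submodule.smul_induction_on hn ?_ ?_
  · intro c hc m hm
    rw [Ideal.mem_span_range_iff_exists_fun] at hc
    obtain ⟨t, rfl⟩ := hc
    refine ⟨fun x => t x • m, fun x => N.smul_mem _ hm, ?_⟩
    rw [Finset.sum_smul]
    exact Finset.sum_congr rfl fun x _ => by rw [smul_smul, mul_comm]
  · rintro _ _ ⟨g, hg, rfl⟩ ⟨g', hg', rfl⟩
    exact ⟨g + g', fun x => add_mem (hg x) (hg' x), by
      simp [smul_add, Finset.sum_add_distrib]⟩

/-- A homogeneous element of `𝔪_E M_p` has homogeneous coefficients: project each of them to the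
right degree, which keeps it in `M_p`. -/
theorem exists_eq_sum_mulX {p : ℕ} {f : Fin (P.β p) → MvPolynomial (Fin r) k}
    (hf : f ∈ freePart k (P.deg p) a ∅)
    (hfm : f ∈ Ideal.span (Set.range (X : Fin r → MvPolynomial (Fin r) k)) • P.M p) :
    ∃ h : Fin r → Fin (P.β p) → MvPolynomial (Fin r) k,
      (∀ x, h x ∈ freePart k (P.deg p) a {x} ⊓ P.syz p) ∧ f = ∑ x, mulX k (P.β p) x (h x) := by
  obtain ⟨g, hg, hfg⟩ := exists_eq_sum_X_smul hfm
  refine ⟨fun x => freeProj k (P.deg p) a {x} (g x),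
    fun x => ⟨freeProj_mem _, P.freeProj_mem_syz (hg x)⟩, ?_⟩
  have hx : ∀ x, mulX k (P.β p) x (freeProj k (P.deg p) a {x} (g x)) =
      freeProj k (P.deg p) a ∅ (mulX k (P.β p) x (g x)) := fun x => by
    have := LinearMap.congr_fun (mulX_comp_freeProj_erase (k := k) (deg := P.deg p) (a := a)
      (Finset.mem_singleton_self x)) (g x)
    rwa [Finset.erase_singleton] at this
  simp only [hx]
  rw [← map_sum]
  simp only [mulX_eq_smul]
  rw [← hfg, freeProj_eq_self hf]

theorem koszul_sum_single_singleton {X N : Type*} [Fintype X] [LinearOrder X] [AddCommGroup N]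
    [Module k N] (y : X → N →ₗ[k] N) (h : X → N) :
    koszul y (∑ x, Finsupp.single {x} (h x)) = Finsupp.single ∅ (∑ x, y x (h x)) := by
  rw [map_sum, Finsupp.single_finsetSum]
  refine Finset.sum_congr rfl fun x _ => ?_
  rw [koszul_single, Finset.sum_singleton, Finset.erase_singleton]
  simp [sgn, Finset.filter_singleton]

theorem koszul_mulX_apply_empty_mem {p : ℕ}
    {w : Finset (Fin r) →₀ (Fin (P.β p) → MvPolynomial (Fin r) k)} (hw : ∀ F, w F ∈ P.syz p) :
    koszul (mulX k (P.β p)) w ∅ ∈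
      (Ideal.span (Set.range (X : Fin r → MvPolynomial (Fin r) k)) • P.M p).restrictScalars k := by
  refine koszul_apply_empty_mem fun F x => ?_
  rw [mulX_eq_smul, Submodule.restrictScalars_mem]
  exact Submodule.smul_mem_smul (Ideal.subset_span ⟨x, rfl⟩) (hw F)

/-- Degree `0` chains live at `∅` and are elements of `(M_p)_a`; the boundaries, coming from
singletons, are the sums of multiples `Y_x h_x`, which make up `(𝔪_E M_p)_a`. -/
theorem syzHomology_zero_equiv_W (p : ℕ) :
    Nonempty (P.SyzHomology a p 0 ≃ₗ[k] P.W p a) := by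
  classical
  set 𝒩 : Finset (Fin r) → Submodule k (Fin (P.β p) → MvPolynomial (Fin r) k) :=
    fun F => freePart k (P.deg p) a F ⊓ P.syz p with h𝒩
  have hval : ∀ z ∈ koszulPart 𝒩 0, z = Finsupp.single ∅ (z ∅) := by
    intro z hz
    ext1 F
    by_cases hF : F = ∅
    · subst hF; simp
    · rw [Finsupp.single_eq_of_ne hF]
      by_contra h
      have := (hz F).2 h
      rw [Nat.cast_eq_zero, Finset.card_eq_zero] at this
      exact hF this
  refine subquotient_equiv (P := P.MComponent p a) (Finsupp.lsingle ∅ ∘ₗ Submodule.subtype _)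
    (Submodule.subtype _) ?_ (fun f => f.2) ?_ (fun f hf => ⟨⟨f, hf⟩, by simp⟩) ?_
  · rintro ⟨f, hf⟩
    exact ⟨single_mem_koszulPart ((P.mem_MComponent a).1 hf) rfl, by
      simp [koszul_single]⟩
  · rintro z ⟨hz, -⟩
    refine ⟨⟨z ∅, (P.mem_MComponent a).2 (hz ∅).1⟩, ?_⟩
    have := hval z hz
    simp [← this]
  · rintro ⟨f, hf⟩
    constructor
    · rintro ⟨w, hw, hwf⟩
      have hwf' : koszul (mulX k (P.β p)) w ∅ = f := by
        rw [hwf]; simp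
      have := P.koszul_mulX_apply_empty_mem fun F => (hw F).1.2
      rwa [hwf'] at this
    · intro hfm
      obtain ⟨h, hh, hfh⟩ := P.exists_eq_sum_mulX a ((P.mem_MComponent a).1 hf).1 hfm
      refine ⟨∑ x, Finsupp.single {x} (h x),
        sum_mem fun x _ => single_mem_koszulPart (hh x) rfl, ?_⟩
      rw [koszul_sum_single_singleton, ← hfh]
      rfl

end GradedFreeResolution

/-- The Koszul homology of `k[S]` in degree `a` is the homology of `T_a`. -/
theorem algHomology_equiv_reducedHomology_T {d r s : ℕ} (A : Fin r ⊕ Fin s → Fin d → ℤ)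
    (k : Type*) [Field k] (a : semigroup A) (i : ℤ) :
    Nonempty (GradedFreeResolution.AlgHomology A k a (i + 1) ≃ₗ[k]
      ReducedHomology k (T A a) i) := by
  classical
  -- The sum of coefficients, sending every `χ^b` to `1`, turns multiplication by `χ^{a_x}` into the
  -- identity.
  let ε : AddMonoidAlgebra k (semigroup A) →ₗ[k] k :=
    Finsupp.linearCombination k (fun _ => (1 : k)) ∘ₗ
      (AddMonoidAlgebra.coeffLinearEquiv k).toLinearMap
  have hεs : ∀ b t, ε (AddMonoidAlgebra.single b t) = t := fun b t => by
    simp [ε, Finsupp.linearCombination_single]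
  have hεy : ∀ x, ε ∘ₗ algMulX A k x = LinearMap.id ∘ₗ ε := by
    intro x
    refine AddMonoidAlgebra.lhom_ext' fun b => LinearMap.ext_ring ?_
    change ε (AddMonoidAlgebra.single (gen A (Sum.inl x)) 1 * AddMonoidAlgebra.single b 1) =
      ε (AddMonoidAlgebra.single b 1)
    rw [AddMonoidAlgebra.single_mul_single, hεs, hεs, one_mul]
  -- `S` is cancellative, so at most one `b` has the required degree and each component of `k[S]` is
  -- at most a line.
  have hpart : ∀ F, ∀ n ∈ algPart k a F, n ≠ 0 → ∃ b t, b + ∑ x ∈ F, gen A (Sum.inl x) = a ∧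
      n = AddMonoidAlgebra.single b t := by
    intro F n hn hn0
    obtain ⟨b, hb⟩ : ∃ b, n.coeff b ≠ 0 := by
      by_contra! h
      exact hn0 (AddMonoidAlgebra.ext (Finsupp.ext h))
    refine ⟨b, n.coeff b, hn b hb, ?_⟩
    ext c
    by_cases hbc : c = b
    · subst hbc; simp
    · rw [AddMonoidAlgebra.coeff_single, Finsupp.single_eq_of_ne hbc]
      by_contra h
      exact hbc (add_right_cancel ((hn c h).trans (hn b hb).symm))
  have hεinj : ∀ F, ∀ n ∈ algPart k a F, ε n = 0 → n = 0 := by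
    intro F n hn hε
    by_contra h
    obtain ⟨b, t, -, rfl⟩ := hpart F n hn h
    rw [hεs] at hε
    exact h (by rw [hε]; simp)
  have hy : ∀ F, ∀ x ∈ F, ∀ n ∈ algPart k a F, algMulX A k x n ∈ algPart k a (F.erase x) := by
    intro F x hx n hn
    by_cases hn0 : n = 0
    · rw [hn0, map_zero]; exact zero_mem _
    · obtain ⟨b, t, hb, rfl⟩ := hpart F n hn hn0
      intro c hc
      change (AddMonoidAlgebra.single (gen A (Sum.inl x)) 1 *
        AddMonoidAlgebra.single b t).coeff c ≠ 0 at hc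
      rw [AddMonoidAlgebra.single_mul_single, AddMonoidAlgebra.coeff_single,
        Finsupp.single_apply] at hc
      split_ifs at hc with h
      · rw [← h, ← hb, ← Finset.add_sum_erase F _ hx]; abel
      · exact absurd rfl hc
  -- A face of dimension `i` has `i + 1` vertices, hence the index shift.
  have hmap : ∀ i j : ℤ, j = i + 1 → (koszulPart (algPart k a) j).map
      (Finsupp.mapRange.linearMap ε) = chains k (T A a) i := by
    rintro i _ rfl
    apply le_antisymm
    · rintro _ ⟨z, hz, rfl⟩
      rw [mem_chains]
      intro F hF
      rw [Finsupp.mapRange.linearMap_apply, Finsupp.mapRange_apply] at hF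
      have h0 : z F ≠ 0 := fun h => hF (by rw [h, map_zero])
      obtain ⟨b, -, hb, -⟩ := hpart F _ (hz F).1 h0
      exact ⟨mem_T.2 ⟨b, hb⟩, (hz F).2 h0⟩
    · intro z hz
      refine map_mem_of_forall_single LinearMap.id fun F hF => ?_
      obtain ⟨hFT, hFi⟩ := mem_chains.1 hz F hF
      obtain ⟨b, hb⟩ := mem_T.1 hFT
      refine ⟨Finsupp.single F (AddMonoidAlgebra.single b (z F)),
        single_mem_koszulPart ?_ hFi, ?_⟩
      · intro c hc
        rw [AddMonoidAlgebra.coeff_single, Finsupp.single_apply] at hc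
        split_ifs at hc with h
        · rw [← h, hb]
        · exact absurd rfl hc
      · rw [Finsupp.mapRange.linearMap_apply, Finsupp.mapRange_single, hεs]
        rfl
  have hinj : ∀ i, ∀ z ∈ koszulPart (algPart k a) i,
      Finsupp.mapRange.linearMap (α := Finset (Fin r)) ε z = 0 → z = 0 := by
    intro i z hz h
    ext1 F
    exact hεinj F _ (hz F).1 (DFunLike.congr_fun h F)
  refine homology_equiv_of_bijective (A' := chains k (T A a)) (D' := boundary k (Fin r))
    (Finsupp.mapRange.linearMap ε) ?_
    (fun z hz => koszul_mem_koszulPart hy rfl hz) (hmap _ _ rfl) (hmap _ _ rfl) (hinj _) (hinj _)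
    (fun z hz => koszul_mem_koszulPart hy (by ring) hz)
  rw [boundary_eq_koszul]
  exact mapRange_comp_koszul _ _ _ hεy

end ShortResolution

open ShortResolution
theorem mainTheorem4 {d r s : ℕ} (A : Fin r ⊕ Fin s → Fin d → ℤ)
    (hA : FiniteFactorizations A) (hE : IsConvexPartition A)
    (ρ : Fin r ⊕ Fin s → ℕ) (hρ : IsVariableOrder ρ) (k : Type*) [Field k] :
    (∀ (a : semigroup A) (i : ℤ),
      Nonempty (ReducedHomology k (ShortResolution.Γ A ρ k a) i ≃ₗ[k]
        ReducedHomology k (ShortResolution.T A a) i)) ∧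
    (∀ P : GradedFreeResolution A k, P.IsMinimal → ∀ a : semigroup A,
      (∀ i : ℕ, Nonempty (ReducedHomology k (ShortResolution.Γ A ρ k a) i ≃ₗ[k] P.W i a)) ∧
      (∀ p : ℕ, Module.rank k (ReducedHomology k (ShortResolution.Γ A ρ k a) ((p : ℤ) - 1)) =
        (P.betti p a : Cardinal))) := by
  refine ⟨reducedHomology_Γ_equiv_T hA hρ k, fun P hP a => ⟨fun i => ?_, fun p => ?_⟩⟩
  · obtain ⟨e₁⟩ := reducedHomology_Γ_equiv_T hA hρ k a i
    obtain ⟨e₂⟩ := algHomology_equiv_reducedHomology_T A k a i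
    obtain ⟨e₃⟩ := GradedFreeResolution.algHomology_equiv_syzHomology a hP i
    obtain ⟨e₄⟩ := P.syzHomology_zero_equiv_W a i
    exact ⟨e₁.trans (e₂.symm.trans (e₃.trans e₄))⟩
  -- The subtraction is in `ℤ`: for `p = 0` it gives reduced homology in degree `-1`, matching
  -- Koszul homology in degree `0`.
  · obtain ⟨e₁⟩ := reducedHomology_Γ_equiv_T hA hρ k a (p - 1)
    obtain ⟨e₂⟩ := algHomology_equiv_reducedHomology_T A k a (p - 1)
    rw [sub_add_cancel] at e₂
    rw [e₁.rank_eq, ← e₂.rank_eq, GradedFreeResolution.rank_algHomology a hP]
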